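/- Let $1\le k\le n$ be integers. Let $\mathcal{L}_k^n$ be the Grassmannian of $k$-dimensional linear subspaces of $\mathbb{R}^n$, equipped with its rotation invariant measure $\mathrm{d}L$ of total mass $$\|\mathcal{L}_k^n\| = \frac{\sigma_n\,\sigma_{n-1}\cdots\sigma_{n-k+1}}{\sigma_1\,\sigma_2\cdots\sigma_k},\qquad \sigma_m = \frac{2\pi^{m/2}}{\Gamma(m/2)},$$ that is, the image of the Haar probability measure of the orthogonal group $O(n)$ under $g\mapsto gL_0$, for a fixed $k$-dimensional subspace $L_0$, multiplied by this constant. For $L\in\mathcal{L}_k^n$ let $S(L)$ be the $(k-1)$-dimensional unit sphere in $L$ with its surface measure (the counting measure on two points if $k=1$). For $u=(u_0,\dots,u_k)\in S(L)^{k+1}$ let $\mathrm{Vol}(u)$ be the $k$-dimensional volume of the convex hull of $u_0,\dots,u_k$, and write $z+ru=(z+ru_0,\dots,z+ru_k)$. Then for every Lebesgue measurable function $f\colon(\mathbb{R}^n)^{k+1}\to[0,\infty]$, $$\int_{(\mathbb{R}^n)^{k+1}} f(x)\,\mathrm{d}x = \int_{L\in\mathcal{L}_k^n}\int_{z\in\mathbb{R}^n}\int_{r\ge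 0}\int_{u\in S(L)^{k+1}} f(z+ru)\,r^{nk-1}\,\bigl(k!\,\mathrm{Vol}(u)\bigr)^{n-k+1}\,\mathrm{d}u\,\mathrm{d}r\,\mathrm{d}z\,\mathrm{d}L,$$ where $\mathrm{d}x$, $\mathrm{d}z$ and $\mathrm{d}r$ are Lebesgue measures and $\mathrm{d}u$ is the product of the surface measures; both sides may be infinite. -/

import Mathlib

open MeasureTheory Set
open scoped ENNReal Nat

/-- Euclidean space `ℝⁿ`. -/
abbrev Rn (n : ℕ) : Type := EuclideanSpace ℝ (Fin n)

/-- The area `2 π^{m/2} / Γ(m/2)` of the unit sphere of `ℝᵐ`. -/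
noncomputable def sphereArea (m : ℕ) : ℝ :=
  2 * √Real.pi ^ m / Real.Gamma ((m : ℝ) / 2)

section General

variable (E : Type) [NormedAddCommGroup E] [InnerProductSpace ℝ E] [FiniteDimensional ℝ E]

/-- The orthogonal group of a Euclidean space, as linear operators with the operator norm
topology. -/
abbrev OrthGroup : Type := unitary (E →L[ℝ] E)

instance OrthGroup.instCompactSpace : CompactSpace (OrthGroup E) := by
  refine (isCompact_iff_compactSpace (s := (unitary (E →L[ℝ] E) : Set (E →L[ℝ] E)))).mp ?_
  have : ProperSpace (E →L[ℝ] E) := FiniteDimensional.proper ℝ _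
  refine (isCompact_closedBall (0 : E →L[ℝ] E) 1).of_isClosed_subset isClosed_unitary ?_
  intro A hA
  rw [mem_closedBall_zero_iff]
  refine ContinuousLinearMap.opNorm_le_bound _ zero_le_one fun x => ?_
  rw [one_mul]
  exact (Unitary.norm_map ⟨A, hA⟩ x).le

/-- The Haar probability measure on the orthogonal group. -/
noncomputable def OrthGroup.haarProb : Measure (OrthGroup E) :=
  Measure.haarMeasure ⊤

/-- The Grassmannian of `k`-dimensional linear subspaces of `E`. -/
@[ext]
structure LGrass (k : ℕ) where
  toSubmodule : Submodule ℝ E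
  finrank_eq : Module.finrank ℝ toSubmodule = k

end General

namespace LGrass

section General

variable {E : Type} [NormedAddCommGroup E] [InnerProductSpace ℝ E] [FiniteDimensional ℝ E] {k : ℕ}

/-- The topology in which subspaces are close when their orthogonal projections are close in the
operator norm. -/
noncomputable instance instTopologicalSpace : TopologicalSpace (LGrass E k) :=
  TopologicalSpace.induced (fun L => L.1.starProjection) inferInstance

noncomputable instance instMeasurableSpace : MeasurableSpace (LGrass E k) := borel _

instance instBorelSpace : BorelSpace (LGrass E k) := ⟨rfl⟩

/-- The image `g L` of a subspace `L` under an orthogonal transformation `g`. -/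
noncomputable def rotate (g : OrthGroup E) (L : LGrass E k) : LGrass E k :=
  ⟨L.1.map (Unitary.linearIsometryEquiv g).toLinearEquiv.toLinearMap, by
    rw [LinearEquiv.finrank_map_eq]
    exact L.2⟩

theorem continuous_rotate (L : LGrass E k) : Continuous fun g : OrthGroup E => rotate g L := by
  rw [continuous_induced_rng]
  have h : ((fun L : LGrass E k => L.1.starProjection) ∘ fun g : OrthGroup E => rotate g L) =
      fun g : OrthGroup E => (g : E →L[ℝ] E) * L.1.starProjection * star (g : E →L[ℝ] E) := by
    funext g
    ext1 x
    exact Submodule.starProjection_map_apply (Unitary.linearIsometryEquiv g) L.1 x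
  rw [h]
  fun_prop

/-- The unit sphere `S(L)` inside the subspace `L`. -/
abbrev unitSphere (L : LGrass E k) : Type := Metric.sphere (0 : L.1) 1

variable [MeasurableSpace E] [BorelSpace E]

/-- The `k`-dimensional Lebesgue measure on the subspace `L`, which gives mass one to the unit
cube of any orthonormal basis of `L`. -/
noncomputable def lebesgue (L : LGrass E k) : Measure L.1 :=
  @volume L.1 measureSpaceOfInnerProductSpace

/-- The surface measure on the unit sphere of `L`. When `k = 1` it is the counting measure on the
two unit vectors. -/
noncomputable def sphereMeasure (L : LGrass E k) : Measure L.unitSphere :=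
  L.lebesgue.toSphere

/-- The `k`-dimensional volume of the simplex spanned by `k + 1` points of the unit sphere
of `L`. -/
noncomputable def simplexVolume (L : LGrass E k) (u : Fin (k + 1) → L.unitSphere) : ℝ≥0∞ :=
  L.lebesgue (convexHull ℝ (range fun i => (u i : L.1)))

end General

/-- The subspace of `ℝⁿ` spanned by the first `k` standard basis vectors. -/
noncomputable def coordPlane {k n : ℕ} (hkn : k ≤ n) : LGrass (Rn n) k :=
  ⟨Submodule.span ℝ (range fun i : Fin k => EuclideanSpace.single (Fin.castLE hkn i) (1 : ℝ)), by
    have h := (EuclideanSpace.orthonormal_single (𝕜 := ℝ) (ι := Fin n)).comp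
      (Fin.castLE hkn) (Fin.castLE_injective hkn)
    exact (finrank_span_eq_card h.linearIndependent).trans (Fintype.card_fin k)⟩

/-- The total mass `σₙ σₙ₋₁ ⋯ σₙ₋ₖ₊₁ / (σ₁ σ₂ ⋯ σₖ)` of the Grassmannian. -/
noncomputable def mass (k n : ℕ) : ℝ :=
  (∏ i ∈ Finset.range k, sphereArea (n - i)) / ∏ i ∈ Finset.range k, sphereArea (i + 1)

/-- The rotation invariant measure on the Grassmannian with total mass `LGrass.mass k n`. -/
noncomputable def measure {k n : ℕ} (hkn : k ≤ n) : Measure (LGrass (Rn n) k) :=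
  ENNReal.ofReal (mass k n) • (OrthGroup.haarProb (Rn n)).map fun g => rotate g (coordPlane hkn)

end LGrass

/-!
The formula is an affine and spherical form of the Blaschke–Petkantschin formula. It is assembled
from two formulas, each of them a change of variables that avoids differential forms.

*Linear part.* For a fixed `k`-plane `ι(ℝᵏ)` in `ℝⁿ`, Lebesgue measure on `k`-tuples of vectors is
produced by a tuple `Y` in `ℝᵏ`, distributed with density `|det Y| ^ (n - k)`, and a Haar distributed
rotation `g`, as `g ι Y` (`lintegral_eq_lintegral_rotate`). The Gram–Schmidt process expresses
Lebesgue measure on `(ℝⁿ)ᵏ` through a Haar rotation and a triangular `k × k` matrix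
(`lintegral_eq_lintegral_triMeasure`): the vectors are introduced one after the other, and after
averaging over the rotations the integrand is, as a function of the newest vector, invariant under
the rotations fixing the previous ones, so that it is integrated in cylindrical coordinates. The
same process in `ℝᵏ` gives the same triangular matrices up to the power `n - k` of their determinant
and a rotation of `ℝᵏ`. The latter extends to `ℝⁿ` and is absorbed by the right invariance of Haar
measure; the quotient of the sphere areas is the total mass of the Grassmannian.

*Spherical part.* In `ℝᵏ`, the edges of a simplex are `r (uᵢ - u₀)` with `r` the circumradius and
`uᵢ` unit vectors, and Lebesgue measure on the edges has density `r ^ (k² - 1) |det (uᵢ - u₀)|`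
(`lintegral_eq_lintegral_spherical`). To see this without computing a Jacobian of the circumcentre,
let the vertices `y₀, …, yₖ` of a simplex have squared norms `‖yᵢ‖² = ‖y₀‖² + wᵢ`. Lebesgue measure
on the simplices is disintegrated over `w` in two ways: for fixed edges, `w` is an affine function of
the position `y₀` with determinant `2ᵏ det` (`lintegral_lintegral_centred`), and in polar coordinates
`w` replaces the radii of `y₁, …, yₖ` (`lintegral_placed`). The two disintegrations agree for almost
all `w`. For continuous test functions both sides are continuous in `w`, so they agree at `w = 0`,
where all vertices lie on one sphere around the origin (`lintegral_centred_zero`).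

*Conclusion.* For `k + 1` points of `ℝⁿ`, the linear formula is applied to the edges, the spherical
formula inside the plane of the edges, and the base point is replaced by the centre of the sphere,
which is a translation. This gives the formula with an average over rotations in place of the
integral over the Grassmannian (`lintegral_eq_lintegral_flatIntegral`), and `|det (uᵢ - u₀)|` is
`k!` times the volume of the simplex (`factorial_mul_volume_convexHull`). The rotations act
transitively on the Grassmannian, and the inner integral depends on the rotated plane only. Its
measurability on the Grassmannian follows from that on the orthogonal group, which is Polish
(`LGrass.measurable_sphereIntegral`). A Lebesgue measurable `f` is compared with a Borel function by
means of the formula for the indicator function of a null set.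
-/


/-! ### Haar measure on the orthogonal group -/

section Haar

variable {E : Type} [NormedAddCommGroup E] [InnerProductSpace ℝ E] [FiniteDimensional ℝ E]

instance OrthGroup.isHaarMeasure_haarProb : (OrthGroup.haarProb E).IsHaarMeasure := by
  unfold OrthGroup.haarProb
  infer_instance

instance OrthGroup.isProbabilityMeasure_haarProb : IsProbabilityMeasure (OrthGroup.haarProb E) :=
  ⟨Measure.haarMeasure_self (K₀ := (⊤ : TopologicalSpace.PositiveCompacts (OrthGroup E)))⟩

/-- The orthogonal group is compact, hence unimodular: right translates of the Haar probability
measure are Haar probability measures. -/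
instance OrthGroup.isMulRightInvariant_haarProb : (OrthGroup.haarProb E).IsMulRightInvariant := by
  refine ⟨fun g => ?_⟩
  have h1 : IsProbabilityMeasure (Measure.map (· * g) (OrthGroup.haarProb E)) :=
    Measure.isProbabilityMeasure_map (measurable_mul_const g).aemeasurable
  have h2 := Measure.isHaarMeasure_map_mul_right (OrthGroup.haarProb E) g
  exact Measure.isHaarMeasure_eq_of_isProbabilityMeasure _ _

theorem OrthGroup.lintegral_comp_mul_right (F : OrthGroup E → ℝ≥0∞) (a : E ≃ₗᵢ[ℝ] E) :
    ∫⁻ g, F (g * Unitary.linearIsometryEquiv.symm a) ∂(OrthGroup.haarProb E) =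
      ∫⁻ g, F g ∂(OrthGroup.haarProb E) :=
  lintegral_mul_right_eq_self F _

theorem OrthGroup.mul_symm_apply (g : OrthGroup E) (a : E ≃ₗᵢ[ℝ] E) (v : E) :
    ((g * Unitary.linearIsometryEquiv.symm a : OrthGroup E) : E →L[ℝ] E) v =
      (g : E →L[ℝ] E) (a v) := by
  rfl

theorem OrthGroup.lintegral_comp_apply [MeasurableSpace E] [BorelSpace E] (g : OrthGroup E)
    (F : E → ℝ≥0∞) :
    ∫⁻ v, F ((g : E →L[ℝ] E) v) ∂(@volume E measureSpaceOfInnerProductSpace) =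
      ∫⁻ v, F v ∂(@volume E measureSpaceOfInnerProductSpace) :=
  (Unitary.linearIsometryEquiv g).measurePreserving.lintegral_comp_emb
    (Unitary.linearIsometryEquiv g).toHomeomorph.measurableEmbedding F

theorem OrthGroup.measurable_apply [MeasurableSpace E] [BorelSpace E] :
    Measurable fun p : OrthGroup E × E => (p.1 : E →L[ℝ] E) p.2 := by
  apply Continuous.measurable
  fun_prop

end Haar

/-! ### Polar coordinates -/

section Polar

variable {E : Type*} [NormedAddCommGroup E] [InnerProductSpace ℝ E] [FiniteDimensional ℝ E]
  [MeasurableSpace E] [BorelSpace E] [Nontrivial E] (μ : Measure E) [μ.IsAddHaarMeasure]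

theorem lintegral_eq_lintegral_toSphere {F : E → ℝ≥0∞} (hF : Measurable F) :
    ∫⁻ x, F x ∂μ = ∫⁻ u, (∫⁻ r in Ioi (0 : ℝ),
      ENNReal.ofReal (r ^ (Module.finrank ℝ E - 1)) * F (r • (u : E))) ∂μ.toSphere := by
  have h0 : ∫⁻ x, F x ∂μ = ∫⁻ x in ({0}ᶜ : Set E), F x ∂μ := by
    rw [restrict_compl_singleton]
  rw [h0, ← lintegral_subtype_comap (measurableSet_singleton _).compl]
  have h1 := μ.measurePreserving_homeomorphUnitSphereProd.lintegral_comp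
    (f := fun p => F (p.2.1 • (p.1 : E))) (by fun_prop)
  have h2 : ∀ x : ({0}ᶜ : Set E), ((homeomorphUnitSphereProd E x).2.1 •
      ((homeomorphUnitSphereProd E x).1 : E)) = x := by
    intro x
    have : ‖(x : E)‖ ≠ 0 := norm_ne_zero_iff.2 x.2
    simp [smul_smul, this]
  simp only [h2] at h1
  rw [h1, lintegral_prod _ (by fun_prop)]
  refine lintegral_congr fun u => ?_
  rw [Measure.volumeIoiPow, lintegral_withDensity_eq_lintegral_mul _ (by fun_prop) (by fun_prop),
    ← lintegral_subtype_comap measurableSet_Ioi]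
  rfl

theorem lintegral_fun_norm_eq {F : ℝ → ℝ≥0∞} (hF : Measurable F) :
    ∫⁻ x, F ‖x‖ ∂μ = μ.toSphere univ * ∫⁻ r in Ioi (0 : ℝ),
      ENNReal.ofReal (r ^ (Module.finrank ℝ E - 1)) * F r := by
  rw [lintegral_eq_lintegral_toSphere μ (by fun_prop), mul_comm, ← lintegral_const]
  refine lintegral_congr fun u => setLIntegral_congr_fun measurableSet_Ioi fun r hr => ?_
  have : ‖(u : E)‖ = 1 := by simp
  simp [norm_smul, abs_of_pos (show (0 : ℝ) < r from hr), this]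

end Polar

theorem toSphere_univ_eq_sphereArea {ι : Type*} [Fintype ι] [Nonempty ι] :
    (volume : Measure (EuclideanSpace ℝ ι)).toSphere univ =
      ENNReal.ofReal (sphereArea (Fintype.card ι)) := by
  have hm : (0 : ℝ) < Fintype.card ι := by exact_mod_cast Fintype.card_pos
  rw [Measure.toSphere_apply_univ, EuclideanSpace.volume_ball, finrank_euclideanSpace,
    ENNReal.ofReal_one, one_pow, one_mul, ← ENNReal.ofReal_natCast,
    ← ENNReal.ofReal_mul (by positivity), sphereArea, Real.Gamma_add_one (by positivity)]
  congr 1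
  have := (Real.Gamma_pos_of_pos (half_pos hm)).ne'
  field_simp

theorem sphereArea_pos {m : ℕ} (hm : 0 < m) : 0 < sphereArea m := by
  have : 0 < Real.Gamma ((m : ℝ) / 2) := Real.Gamma_pos_of_pos (by positivity)
  unfold sphereArea
  positivity

/-! ### Coordinate inclusions and triangular vectors -/

/-- The isometric inclusion `ℝᵏ → ℝⁿ` onto the first `k` coordinates. -/
noncomputable def coordIncl {k n : ℕ} (hkn : k ≤ n) : Rn k →ₗᵢ[ℝ] Rn n :=
  LinearMap.isometryOfOrthonormal (v := (EuclideanSpace.basisFun (Fin k) ℝ).toBasis)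
    ((EuclideanSpace.basisFun (Fin k) ℝ).toBasis.constr ℝ
      fun i => EuclideanSpace.single (Fin.castLE hkn i) (1 : ℝ))
    (by simp [(EuclideanSpace.basisFun (Fin k) ℝ).orthonormal])
    (by
      have h := (EuclideanSpace.orthonormal_single (𝕜 := ℝ) (ι := Fin n)).comp
        (Fin.castLE hkn) (Fin.castLE_injective hkn)
      convert h using 1
      ext1 i
      simp)

theorem coordIncl_eq_sum {k n : ℕ} (hkn : k ≤ n) (x : Rn k) :
    coordIncl hkn x = ∑ i, x i • EuclideanSpace.single (Fin.castLE hkn i) (1 : ℝ) := by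
  change (EuclideanSpace.basisFun (Fin k) ℝ).toBasis.constr ℝ
    (fun i => EuclideanSpace.single (Fin.castLE hkn i) (1 : ℝ)) x = _
  rw [Module.Basis.constr_apply_fintype]
  simp

theorem coordIncl_apply {k n : ℕ} (hkn : k ≤ n) (x : Rn k) (l : Fin n) :
    coordIncl hkn x l = if h : l.val < k then x ⟨l, h⟩ else 0 := by
  rw [coordIncl_eq_sum]
  simp only [WithLp.ofLp_sum, Finset.sum_apply, PiLp.smul_apply, PiLp.single_apply,
    smul_eq_mul, mul_ite, mul_one, mul_zero]
  split_ifs with h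
  · rw [Finset.sum_eq_single ⟨l, h⟩]
    · simp
    · intro b _ hb
      rw [if_neg]
      rintro rfl
      exact hb rfl
    · simp
  · refine Finset.sum_eq_zero fun i _ => if_neg ?_
    rintro rfl
    exact h i.2

theorem coordIncl_self {n : ℕ} (x : Rn n) : coordIncl le_rfl x = x := by
  ext l
  simp [coordIncl_apply]

/-- The vector `(a₀, …, aⱼ₋₁, ρ, 0, …, 0)` of `ℝᵐ`. -/
noncomputable def triVec (m j : ℕ) (a : Fin j → ℝ) (ρ : ℝ) : Rn m :=
  WithLp.toLp 2 fun l => if h : l.val < j then a ⟨l, h⟩ else if l.val = j then ρ else 0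

theorem measurable_triVec (m j : ℕ) :
    Measurable fun p : (Fin j → ℝ) × ℝ => triVec m j p.1 p.2 := by
  refine (WithLp.measurable_toLp 2 _).comp (measurable_pi_lambda _ fun l => ?_)
  split_ifs <;> fun_prop

theorem coordIncl_triVec {k n j : ℕ} (hkn : k ≤ n) (hj : j < k) (a : Fin j → ℝ) (ρ : ℝ) :
    coordIncl hkn (triVec k j a ρ) = triVec n j a ρ := by
  ext l
  rw [coordIncl_apply]
  simp only [triVec]
  split_ifs <;> first | rfl | omega

/-- Two vectors of the same norm with the same first `j` coordinates are exchanged by a reflection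
which fixes the first `j` basis vectors. -/
theorem exists_isometry_of_norm_eq {n j : ℕ} {v w : Rn n} (hvw : ‖v‖ = ‖w‖)
    (h : ∀ l : Fin n, l.val < j → v l = w l) :
    ∃ a : Rn n ≃ₗᵢ[ℝ] Rn n, (∀ l : Fin n, l.val < j →
      a (EuclideanSpace.single l 1) = EuclideanSpace.single l 1) ∧ a v = w := by
  refine ⟨(ℝ ∙ (v - w))ᗮ.reflection, fun l hl => ?_, Submodule.reflection_sub hvw⟩
  apply Submodule.reflection_mem_subspace_eq_self
  rw [Submodule.mem_orthogonal_singleton_iff_inner_right]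
  simp [EuclideanSpace.inner_single_right, h l hl]

/-- The law of the `j`-th column `(t₀, …, tⱼ₋₁, ρ, 0, …, 0)` of an upper triangular matrix, where
the `tᵢ` are Lebesgue distributed and `ρ > 0` has density `ρ ^ (k - 1 - j)`. -/
noncomputable def colMeasure (k j : ℕ) : Measure (Rn k) :=
  ((volume : Measure (Fin j → ℝ)).prod ((volume.restrict (Ioi 0)).withDensity
    fun ρ : ℝ => ENNReal.ofReal (ρ ^ (k - 1 - j)))).map fun p => triVec k j p.1 p.2

instance (k j : ℕ) : SFinite (colMeasure k j) := by
  unfold colMeasure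
  infer_instance

theorem lintegral_colMeasure (k j : ℕ) {F : Rn k → ℝ≥0∞} (hF : Measurable F) :
    ∫⁻ v, F v ∂(colMeasure k j) = ∫⁻ a : Fin j → ℝ, ∫⁻ ρ in Ioi (0 : ℝ),
      ENNReal.ofReal (ρ ^ (k - 1 - j)) * F (triVec k j a ρ) := by
  have h := measurable_triVec k j
  rw [colMeasure, lintegral_map hF h, lintegral_prod _ (by fun_prop)]
  refine lintegral_congr fun a => ?_
  rw [lintegral_withDensity_eq_lintegral_mul _ (by fun_prop) (by fun_prop)]
  rfl

/-- Cylindrical coordinates: the first `j` coordinates stay Cartesian, and the remaining `n - j` are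
rotated by a symmetry of `H` to their norm `ρ` in position `j`. -/
theorem lintegral_eq_lintegral_triVec {n j : ℕ} (hjn : j < n)
    {H : Rn n → ℝ≥0∞} (hH : Measurable H)
    (hinv : ∀ a : Rn n ≃ₗᵢ[ℝ] Rn n, (∀ l : Fin n, l.val < j →
      a (EuclideanSpace.single l 1) = EuclideanSpace.single l 1) → ∀ v, H (a v) = H v) :
    ∫⁻ v, H v = ENNReal.ofReal (sphereArea (n - j)) *
      ∫⁻ a : Fin j → ℝ, ∫⁻ ρ in Ioi (0 : ℝ),
        ENNReal.ofReal (ρ ^ (n - j - 1)) * H (triVec n j a ρ) := by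
  have htri := measurable_triVec n j
  let e := MeasurableEquiv.piEquivPiSubtypeProd (fun _ : Fin n => ℝ) (fun l : Fin n => l.val < j)
  have he : ∀ a b, ∀ l : Fin n, e.symm (a, b) l =
      if h : l.val < j then a ⟨l, h⟩ else b ⟨l, h⟩ := fun a b l => rfl
  let ι := {l : Fin n // ¬ l.val < j}
  have hι : Fintype.card ι = n - j := by
    have h1 := Fintype.card_subtype_compl (fun l : Fin n => l.val < j)
    have h2 : Fintype.card {l : Fin n // l.val < j} = j := by
      simpa using Fintype.card_congr (Fin.castLEOrderIso hjn.le).toEquiv.symm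
    rw [h1, h2, Fintype.card_fin]
  have : Nonempty ι := ⟨⟨⟨j, hjn⟩, by simp⟩⟩
  let restr : ({l : Fin n // l.val < j} → ℝ) → Fin j → ℝ := fun a i => a ⟨⟨i, i.2.trans hjn⟩, i.2⟩
  have hrestr : MeasurePreserving restr volume volume :=
    volume_measurePreserving_piCongrLeft (fun _ : Fin j => ℝ)
      (Fin.castLEOrderIso hjn.le).toEquiv.symm
  have key : ∀ a (b : EuclideanSpace ℝ ι),
      H (WithLp.toLp 2 (e.symm (a, WithLp.ofLp b))) = H (triVec n j (restr a) ‖b‖) := by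
    intro a b
    have hnorm : ‖(WithLp.toLp 2 (e.symm (a, WithLp.ofLp b)) : Rn n)‖ =
        ‖triVec n j (restr a) ‖b‖‖ := by
      rw [EuclideanSpace.norm_eq, EuclideanSpace.norm_eq]
      congr 1
      rw [← Fintype.sum_subtype_add_sum_subtype (fun l : Fin n => l.val < j),
        ← Fintype.sum_subtype_add_sum_subtype (fun l : Fin n => l.val < j)]
      congr 1
      · refine Finset.sum_congr rfl fun l _ => ?_
        simp [he, triVec, restr, l.2]
      · rw [Finset.sum_eq_single (⟨⟨j, hjn⟩, by simp⟩ : ι) (f := fun l : ι =>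
          ‖triVec n j (restr a) ‖b‖ l‖ ^ 2)]
        · simp only [triVec, lt_irrefl, dite_false, if_true]
          rw [norm_norm, EuclideanSpace.norm_sq_eq]
          refine Finset.sum_congr rfl fun l _ => ?_
          simp [he, l.2]
        · intro l _ hl
          have : l.1.val ≠ j := fun h => hl (Subtype.ext (Fin.ext h))
          simp [triVec, l.2, this]
        · simp
    obtain ⟨g, hg, hgv⟩ := exists_isometry_of_norm_eq hnorm (j := j) fun l hl => by
      simp [he, triVec, hl, restr]
    rw [← hgv, hinv g hg]
  have hradial : ∀ a, ∫⁻ b : EuclideanSpace ℝ ι, H (triVec n j (restr a) ‖b‖) =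
      ENNReal.ofReal (sphereArea (n - j)) * ∫⁻ ρ in Ioi (0 : ℝ),
        ENNReal.ofReal (ρ ^ (n - j - 1)) * H (triVec n j (restr a) ρ) := by
    intro a
    rw [lintegral_fun_norm_eq volume (F := fun ρ => H (triVec n j (restr a) ρ)) (by fun_prop),
      toSphere_univ_eq_sphereArea, finrank_euclideanSpace, hι]
  calc ∫⁻ v, H v = ∫⁻ x : Fin n → ℝ, H (WithLp.toLp 2 x) :=
        ((PiLp.volume_preserving_toLp (Fin n)).lintegral_comp hH).symm
    _ = ∫⁻ p, H (WithLp.toLp 2 (e.symm p)) :=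
        (((volume_preserving_piEquivPiSubtypeProd (fun _ : Fin n => ℝ) (fun l : Fin n => l.val < j)).symm
          ).lintegral_comp (f := fun x : Fin n → ℝ => H (WithLp.toLp 2 x)) (by fun_prop)).symm
    _ = ∫⁻ a, ∫⁻ b, H (WithLp.toLp 2 (e.symm (a, b))) := by
        rw [Measure.volume_eq_prod, lintegral_prod _ (by fun_prop)]
    _ = ∫⁻ a, ∫⁻ b : EuclideanSpace ℝ ι, H (WithLp.toLp 2 (e.symm (a, WithLp.ofLp b))) := by
        refine lintegral_congr fun a => ?_
        exact ((PiLp.volume_preserving_ofLp ι).lintegral_comp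
          (f := fun b => H (WithLp.toLp 2 (e.symm (a, b)))) (by fun_prop)).symm
    _ = ∫⁻ a, ENNReal.ofReal (sphereArea (n - j)) * ∫⁻ ρ in Ioi (0 : ℝ),
          ENNReal.ofReal (ρ ^ (n - j - 1)) * H (triVec n j (restr a) ρ) := by
        simp only [key, hradial]
    _ = _ := by
        rw [lintegral_const_mul' _ _ ENNReal.ofReal_ne_top]
        congr 1
        exact hrestr.lintegral_comp (f := fun a => ∫⁻ ρ in Ioi (0 : ℝ),
          ENNReal.ofReal (ρ ^ (n - j - 1)) * H (triVec n j a ρ))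
          (Measurable.lintegral_prod_right' (f := fun p : (Fin j → ℝ) × ℝ =>
            ENNReal.ofReal (p.2 ^ (n - j - 1)) * H (triVec n j p.1 p.2)) (by fun_prop))

/-- A function on `ℝⁿ` which is invariant under the rotations fixing the first `j` basis vectors is
integrated in cylindrical coordinates; the result is expressed on the smaller space `ℝᵏ`. -/
theorem lintegral_eq_lintegral_colMeasure {k n j : ℕ} (hkn : k ≤ n) (hj : j < k)
    {H : Rn n → ℝ≥0∞} (hH : Measurable H)
    (hinv : ∀ a : Rn n ≃ₗᵢ[ℝ] Rn n, (∀ l : Fin n, l.val < j →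
      a (EuclideanSpace.single l 1) = EuclideanSpace.single l 1) → ∀ v, H (a v) = H v) :
    ∫⁻ v, H v = ENNReal.ofReal (sphereArea (n - j)) *
      ∫⁻ v, H (coordIncl hkn v) * ENNReal.ofReal (v ⟨j, hj⟩) ^ (n - k) ∂(colMeasure k j) := by
  have hι := (coordIncl hkn).continuous.measurable
  rw [lintegral_eq_lintegral_triVec (hj.trans_le hkn) hH hinv, lintegral_colMeasure _ _ (by fun_prop)]
  congr 1
  refine lintegral_congr fun a => setLIntegral_congr_fun measurableSet_Ioi fun ρ hρ => ?_
  have h1 : (triVec k j a ρ) ⟨j, hj⟩ = ρ := by simp [triVec]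
  have hρ' : (0 : ℝ) ≤ ρ := le_of_lt hρ
  simp only [coordIncl_triVec hkn hj, h1]
  rw [ENNReal.ofReal_pow hρ', ENNReal.ofReal_pow hρ',
    show n - j - 1 = (k - 1 - j) + (n - k) by omega, pow_add]
  ring

/-! ### Gram–Schmidt decomposition of Lebesgue measure -/

/-- The law of the first `j` columns of an upper triangular `k × k` matrix whose columns are
independent with laws `colMeasure k 0, …, colMeasure k (j - 1)`. -/
noncomputable def triMeasure (k : ℕ) : (j : ℕ) → Measure (Fin j → Rn k)
  | 0 => Measure.dirac default
  | j + 1 => ((triMeasure k j).prod (colMeasure k j)).map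
      fun p => (Fin.snoc p.1 p.2 : Fin (j + 1) → Rn k)

instance triMeasure.instSFinite (k : ℕ) : ∀ j, SFinite (triMeasure k j)
  | 0 => by unfold triMeasure; infer_instance
  | j + 1 => by
    have := triMeasure.instSFinite k j
    unfold triMeasure
    infer_instance

@[fun_prop]
theorem measurable_finSnoc {α β : Type*} [MeasurableSpace α] [MeasurableSpace β] {j : ℕ}
    {f : α → Fin j → β} {g : α → β} (hf : Measurable f) (hg : Measurable g) :
    Measurable fun p => (Fin.snoc (f p) (g p) : Fin (j + 1) → β) := by
  refine measurable_pi_lambda _ fun i => ?_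
  refine Fin.lastCases ?_ (fun i => ?_) i
  · simpa using hg
  · simp only [Fin.snoc_castSucc]
    exact (measurable_pi_apply i).comp hf

theorem lintegral_triMeasure_succ (k j : ℕ) {F : (Fin (j + 1) → Rn k) → ℝ≥0∞}
    (hF : Measurable F) :
    ∫⁻ T, F T ∂(triMeasure k (j + 1)) =
      ∫⁻ T, ∫⁻ v, F (Fin.snoc T v) ∂(colMeasure k j) ∂(triMeasure k j) := by
  rw [triMeasure, lintegral_map hF (by fun_prop), lintegral_prod _ (by fun_prop)]

theorem ae_colMeasure (k j : ℕ) :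
    ∀ᵐ v ∂(colMeasure k j), (∀ l : Fin k, j < l.val → v l = 0) ∧
      ∀ l : Fin k, l.val = j → 0 < v l := by
  have h1 : MeasurableSet {v : Rn k | (∀ l : Fin k, j < l.val → v l = 0) ∧
      ∀ l : Fin k, l.val = j → 0 < v l} := by
    simp only [ofPred_and, ofPred_forall]
    refine MeasurableSet.inter
      (MeasurableSet.iInter fun l => MeasurableSet.iInter fun _ => ?_)
      (MeasurableSet.iInter fun l => MeasurableSet.iInter fun _ => ?_)
    · exact measurableSet_eq_fun (by fun_prop) (by fun_prop)
    · exact measurableSet_lt (by fun_prop) (by fun_prop)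
  rw [colMeasure, ae_map_iff (measurable_triVec k j).aemeasurable h1]
  have h2 : ∀ᵐ ρ ∂((volume.restrict (Ioi 0)).withDensity
      fun ρ : ℝ => ENNReal.ofReal (ρ ^ (k - 1 - j))), 0 < ρ :=
    (withDensity_absolutelyContinuous _ _).ae_le (ae_restrict_mem measurableSet_Ioi)
  have h3 := (Measure.quasiMeasurePreserving_snd (μ := (volume : Measure (Fin j → ℝ)))
    (ν := (volume.restrict (Ioi 0)).withDensity
      fun ρ : ℝ => ENNReal.ofReal (ρ ^ (k - 1 - j)))).ae h2
  filter_upwards [h3] with p hp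
  refine ⟨fun l hl => ?_, fun l hl => ?_⟩
  · simp [triVec, hl.not_gt, hl.ne']
  · simpa [triVec, hl] using hp

/-- `triMeasure` is carried by upper triangular matrices with positive diagonal. -/
theorem ae_triMeasure (k : ℕ) : ∀ j, ∀ᵐ T ∂(triMeasure k j),
    (∀ (i : Fin j) (l : Fin k), i.val < l.val → T i l = 0) ∧
      ∀ (i : Fin j) (l : Fin k), l.val = i.val → 0 < T i l
  | 0 => Filter.Eventually.of_forall fun T => ⟨fun i => i.elim0, fun i => i.elim0⟩
  | j + 1 => by
    have h1 : MeasurableSet {T : Fin (j + 1) → Rn k |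
        (∀ (i : Fin (j + 1)) (l : Fin k), i.val < l.val → T i l = 0) ∧
          ∀ (i : Fin (j + 1)) (l : Fin k), l.val = i.val → 0 < T i l} := by
      simp only [ofPred_and, ofPred_forall]
      refine MeasurableSet.inter
        (MeasurableSet.iInter fun i => MeasurableSet.iInter fun l => MeasurableSet.iInter fun _ => ?_)
        (MeasurableSet.iInter fun i => MeasurableSet.iInter fun l => MeasurableSet.iInter fun _ => ?_)
      · exact measurableSet_eq_fun (by fun_prop) (by fun_prop)
      · exact measurableSet_lt (by fun_prop) (by fun_prop)
    rw [triMeasure, ae_map_iff (by fun_prop) h1]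
    have h2 := (Measure.quasiMeasurePreserving_fst (μ := triMeasure k j)
      (ν := colMeasure k j)).ae (ae_triMeasure k j)
    have h3 := (Measure.quasiMeasurePreserving_snd (μ := triMeasure k j)
      (ν := colMeasure k j)).ae (ae_colMeasure k j)
    filter_upwards [h2, h3] with p hp hp'
    refine ⟨fun i => ?_, fun i => ?_⟩
    · refine Fin.lastCases (fun l hl => ?_) (fun i l hl => ?_) i
      · simpa using hp'.1 l (by simpa using hl)
      · simpa using hp.1 i l (by simpa using hl)
    · refine Fin.lastCases (fun l hl => ?_) (fun i l hl => ?_) i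
      · simpa using hp'.2 l (by simpa using hl)
      · simpa using hp.2 i l (by simpa using hl)

/-- The product of the diagonal entries of the columns `T`. -/
noncomputable def diagProd {j k : ℕ} (hj : j ≤ k) (T : Fin j → Rn k) : ℝ≥0∞ :=
  ∏ i : Fin j, ENNReal.ofReal (T i (Fin.castLE hj i))

@[fun_prop]
theorem measurable_diagProd {j k : ℕ} (hj : j ≤ k) : Measurable (diagProd hj) := by
  unfold diagProd
  fun_prop

theorem diagProd_snoc {j k : ℕ} (hj : j + 1 ≤ k) (T : Fin j → Rn k) (v : Rn k) :
    diagProd hj (Fin.snoc T v) = diagProd (Nat.le_of_succ_le hj) T * ENNReal.ofReal (v ⟨j, hj⟩) := by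
  rw [diagProd, Fin.prod_univ_castSucc]
  simp only [Fin.snoc_castSucc, Fin.snoc_last]
  rfl

theorem lintegral_pi_finSnoc {β : Type*} [MeasureSpace β] [SigmaFinite (volume : Measure β)] {j : ℕ}
    {F : (Fin (j + 1) → β) → ℝ≥0∞} (hF : Measurable F) :
    ∫⁻ y, F y = ∫⁻ y : Fin j → β, ∫⁻ v, F (Fin.snoc y v) := by
  have h := (volume_preserving_piFinSuccAbove (fun _ : Fin (j + 1) => β) (Fin.last j)).symm
  rw [← h.lintegral_comp hF, Measure.volume_eq_prod, lintegral_prod_symm _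
    (by fun_prop)]
  refine lintegral_congr fun y => lintegral_congr fun v => ?_
  congr 1
  exact Fin.insertNth_last' v y

/-- **Gram–Schmidt decomposition.** Lebesgue measure on `j`-tuples of vectors of `ℝⁿ`, written with
a Haar distributed rotation and a triangular tuple. The weight `diagProd` converts the radial
densities of dimension `k` into those of dimension `n`. -/
theorem lintegral_eq_lintegral_triMeasure {k n : ℕ} (hkn : k ≤ n) : ∀ {j : ℕ} (hj : j ≤ k)
    {H : (Fin j → Rn n) → ℝ≥0∞}, Measurable H →
    ∫⁻ y, H y = (∏ i ∈ Finset.range j, ENNReal.ofReal (sphereArea (n - i))) *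
      ∫⁻ g, ∫⁻ T, H (fun i => (g : Rn n →L[ℝ] Rn n) (coordIncl hkn (T i))) *
        diagProd hj T ^ (n - k) ∂(triMeasure k j) ∂(OrthGroup.haarProb (Rn n))
  | 0, hj, H, hH => by
    simp only [triMeasure, diagProd, Finset.univ_eq_empty, Finset.prod_empty, one_pow, mul_one,
      Finset.range_zero, one_mul, lintegral_dirac]
    have : ∀ y : Fin 0 → Rn n, H y = H default := fun y => congrArg H (Subsingleton.elim _ _)
    simp only [this, lintegral_const]
    simp [volume_pi]
  | j + 1, hj, H, hH => by
    have hact := OrthGroup.measurable_apply (E := Rn n)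
    have hι := (coordIncl hkn).continuous.measurable
    have hact' : ∀ {α : Type} [MeasurableSpace α] {f : α → OrthGroup (Rn n)} {v : α → Rn n},
        Measurable f → Measurable v → Measurable fun p => (f p : Rn n →L[ℝ] Rn n) (v p) :=
      fun hf hv => hact.comp (hf.prodMk hv)
    have hj' : j ≤ k := Nat.le_of_succ_le hj
    -- `Φ T v` averages `H` over all rotations of the tuple `(ι T, v)`
    let Φ : (Fin j → Rn k) → Rn n → ℝ≥0∞ := fun T v => ∫⁻ g : OrthGroup (Rn n),
      H (Fin.snoc (fun i => (g : Rn n →L[ℝ] Rn n) (coordIncl hkn (T i)))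
        ((g : Rn n →L[ℝ] Rn n) v)) ∂(OrthGroup.haarProb (Rn n))
    have hmeas : Measurable fun q : ((Fin j → Rn k) × Rn n) × OrthGroup (Rn n) =>
        H (Fin.snoc (fun i => (q.2 : Rn n →L[ℝ] Rn n) (coordIncl hkn (q.1.1 i)))
          ((q.2 : Rn n →L[ℝ] Rn n) q.1.2)) := by
      refine hH.comp (measurable_finSnoc (measurable_pi_lambda _ fun i => ?_) ?_)
      · exact hact' measurable_snd (by fun_prop)
      · exact hact' measurable_snd (by fun_prop)
    have hΦ : Measurable fun p : (Fin j → Rn k) × Rn n => Φ p.1 p.2 :=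
      Measurable.lintegral_prod_right' hmeas
    have hinv : ∀ T : Fin j → Rn k, (∀ (i : Fin j) (l : Fin k), i.val < l.val → T i l = 0) →
        ∀ a : Rn n ≃ₗᵢ[ℝ] Rn n, (∀ l : Fin n, l.val < j →
          a (EuclideanSpace.single l 1) = EuclideanSpace.single l 1) → ∀ v, Φ T (a v) = Φ T v := by
      intro T hT a ha v
      have hfix : ∀ i, a (coordIncl hkn (T i)) = coordIncl hkn (T i) := by
        intro i
        rw [coordIncl_eq_sum, map_sum]
        refine Finset.sum_congr rfl fun l _ => ?_
        rw [map_smul]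
        by_cases hl : l.val < j
        · rw [ha _ hl]
        · rw [hT i l (by omega), zero_smul, zero_smul]
      have h := OrthGroup.lintegral_comp_mul_right (fun g : OrthGroup (Rn n) =>
        H (Fin.snoc (fun i => (g : Rn n →L[ℝ] Rn n) (coordIncl hkn (T i)))
          ((g : Rn n →L[ℝ] Rn n) v))) a
      simp only [OrthGroup.mul_symm_apply, hfix] at h
      exact h
    have hstep : ∀ᵐ T ∂(triMeasure k j), ∫⁻ v, Φ T v =
        ENNReal.ofReal (sphereArea (n - j)) * ∫⁻ v, Φ T (coordIncl hkn v) *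
          ENNReal.ofReal (v ⟨j, hj⟩) ^ (n - k) ∂(colMeasure k j) := by
      filter_upwards [ae_triMeasure k j] with T hT
      exact lintegral_eq_lintegral_colMeasure hkn hj (by fun_prop) (hinv T hT.1)
    have hH' : Measurable fun y : Fin j → Rn n => ∫⁻ v, H (Fin.snoc y v) :=
      Measurable.lintegral_prod_right' (f := fun p : (Fin j → Rn n) × Rn n => H (Fin.snoc p.1 p.2))
        (by fun_prop)
    set C := ∏ i ∈ Finset.range j, ENNReal.ofReal (sphereArea (n - i))
    calc ∫⁻ y, H y = ∫⁻ y : Fin j → Rn n, ∫⁻ v, H (Fin.snoc y v) := lintegral_pi_finSnoc hH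
      _ = C * ∫⁻ g : OrthGroup (Rn n), ∫⁻ T, (∫⁻ v, H (Fin.snoc
            (fun i => (g : Rn n →L[ℝ] Rn n) (coordIncl hkn (T i))) v)) *
            diagProd hj' T ^ (n - k) ∂(triMeasure k j) ∂(OrthGroup.haarProb (Rn n)) :=
          lintegral_eq_lintegral_triMeasure hkn hj' hH'
      _ = C * ∫⁻ g : OrthGroup (Rn n), ∫⁻ T, (∫⁻ v, H (Fin.snoc
            (fun i => (g : Rn n →L[ℝ] Rn n) (coordIncl hkn (T i)))
            ((g : Rn n →L[ℝ] Rn n) v))) *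
            diagProd hj' T ^ (n - k) ∂(triMeasure k j) ∂(OrthGroup.haarProb (Rn n)) := by
          congr 1
          refine lintegral_congr fun g => lintegral_congr fun T => ?_
          congr 1
          exact (OrthGroup.lintegral_comp_apply g _).symm
      _ = C * ∫⁻ T, (∫⁻ v, Φ T v) * diagProd hj' T ^ (n - k) ∂(triMeasure k j) := by
          rw [lintegral_lintegral_swap]
          · congr 1
            refine lintegral_congr fun T => ?_
            have hm1 : Measurable fun p : OrthGroup (Rn n) × Rn n => H (Fin.snoc
                (fun i => (p.1 : Rn n →L[ℝ] Rn n) (coordIncl hkn (T i)))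
                ((p.1 : Rn n →L[ℝ] Rn n) p.2)) :=
              hmeas.comp (f := fun p : OrthGroup (Rn n) × Rn n => ((T, p.2), p.1)) (by fun_prop)
            rw [lintegral_mul_const _ hm1.lintegral_prod_right', lintegral_lintegral_swap]
            exact hm1.aemeasurable
          · refine Measurable.aemeasurable (Measurable.mul ?_ (by fun_prop))
            exact Measurable.lintegral_prod_right' (hmeas.comp
              (f := fun p : (OrthGroup (Rn n) × (Fin j → Rn k)) × Rn n => ((p.1.2, p.2), p.1.1))
              (by fun_prop))
      _ = C * ∫⁻ T, ENNReal.ofReal (sphereArea (n - j)) * ∫⁻ v, Φ T (coordIncl hkn v) *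
            diagProd hj (Fin.snoc T v) ^ (n - k) ∂(colMeasure k j) ∂(triMeasure k j) := by
          congr 1
          refine lintegral_congr_ae ?_
          filter_upwards [hstep] with T hT
          rw [hT, mul_assoc]
          congr 1
          rw [← lintegral_mul_const _ (by fun_prop)]
          refine lintegral_congr fun v => ?_
          rw [diagProd_snoc, mul_pow]
          ring
      _ = C * ENNReal.ofReal (sphereArea (n - j)) * ∫⁻ T, ∫⁻ v, Φ T (coordIncl hkn v) *
            diagProd hj (Fin.snoc T v) ^ (n - k) ∂(colMeasure k j) ∂(triMeasure k j) := by
          rw [lintegral_const_mul' _ _ ENNReal.ofReal_ne_top, mul_assoc]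
      _ = C * ENNReal.ofReal (sphereArea (n - j)) * ∫⁻ T, ∫⁻ g : OrthGroup (Rn n),
            H (fun i => (g : Rn n →L[ℝ] Rn n) (coordIncl hkn (T i))) *
            diagProd hj T ^ (n - k) ∂(OrthGroup.haarProb (Rn n)) ∂(triMeasure k (j + 1)) := by
          congr 1
          have hm2 : Measurable fun p : (Fin (j + 1) → Rn k) × OrthGroup (Rn n) =>
              H (fun i => (p.2 : Rn n →L[ℝ] Rn n) (coordIncl hkn (p.1 i))) *
              diagProd hj p.1 ^ (n - k) := by
            refine Measurable.mul (hH.comp (measurable_pi_lambda _ fun i => ?_)) (by fun_prop)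
            exact hact' measurable_snd (by fun_prop)
          rw [lintegral_triMeasure_succ _ _ hm2.lintegral_prod_right']
          refine lintegral_congr fun T => lintegral_congr fun v => ?_
          have hm3 : Measurable fun g : OrthGroup (Rn n) =>
              H (fun i => (g : Rn n →L[ℝ] Rn n) (coordIncl hkn
                ((Fin.snoc T v : Fin (j + 1) → Rn k) i))) := by
            refine hH.comp (measurable_pi_lambda _ fun i => ?_)
            exact hact' measurable_id (by fun_prop)
          dsimp only
          rw [lintegral_mul_const _ hm3]
          congr 1
          refine lintegral_congr fun g => congrArg H ?_
          ext1 i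
          refine Fin.lastCases ?_ (fun i => ?_) i <;> simp
      _ = _ := by
          rw [Finset.prod_range_succ, lintegral_lintegral_swap]
          refine Measurable.aemeasurable
            (Measurable.mul (hH.comp (measurable_pi_lambda _ fun i => ?_)) (by fun_prop))
          exact hact' measurable_snd (by fun_prop)

/-! ### The linear Blaschke–Petkantschin formula -/

/-- The determinant of the matrix whose rows are the given `k` vectors of `ℝᵏ`. -/
noncomputable def rowDet {k : ℕ} (Y : Fin k → Rn k) : ℝ :=
  (Matrix.of fun i l => Y i l).det

@[fun_prop]
theorem continuous_rowDet {k : ℕ} : Continuous (rowDet (k := k)) := by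
  unfold rowDet
  refine Continuous.matrix_det (continuous_matrix fun i j => ?_)
  simp only [Matrix.of_apply]
  fun_prop

@[fun_prop]
theorem measurable_rowDet {k : ℕ} : Measurable (rowDet (k := k)) :=
  continuous_rowDet.measurable

theorem rowDet_eq_basis_det {k : ℕ} (Y : Fin k → Rn k) :
    rowDet Y = (EuclideanSpace.basisFun (Fin k) ℝ).toBasis.det Y := by
  rw [Module.Basis.det_apply, rowDet, ← Matrix.det_transpose]
  congr 1

theorem rowDet_comp {k : ℕ} (f : Rn k →ₗ[ℝ] Rn k) (Y : Fin k → Rn k) :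
    rowDet (fun i => f (Y i)) = LinearMap.det f * rowDet Y := by
  rw [rowDet_eq_basis_det, rowDet_eq_basis_det]
  exact Module.Basis.det_comp _ f Y

theorem abs_rowDet_isometry {k : ℕ} (f : Rn k ≃ₗᵢ[ℝ] Rn k) (Y : Fin k → Rn k) :
    |rowDet (fun i => f (Y i))| = |rowDet Y| := by
  have h1 := OrthonormalBasis.det_to_matrix_orthonormalBasis (EuclideanSpace.basisFun (Fin k) ℝ)
    ((EuclideanSpace.basisFun (Fin k) ℝ).map f)
  have h2 := Module.Basis.det_comp (EuclideanSpace.basisFun (Fin k) ℝ).toBasis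
    f.toLinearEquiv.toLinearMap (EuclideanSpace.basisFun (Fin k) ℝ)
  have h3 : (EuclideanSpace.basisFun (Fin k) ℝ).toBasis.det
      (EuclideanSpace.basisFun (Fin k) ℝ) = 1 := by
    simpa using (EuclideanSpace.basisFun (Fin k) ℝ).toBasis.det_self
  have h4 : |LinearMap.det f.toLinearEquiv.toLinearMap| = 1 := by
    rw [h3, mul_one] at h2
    rw [← h2, ← h1]
    rfl
  have h5 := rowDet_comp f.toLinearEquiv.toLinearMap Y
  rw [← one_mul |rowDet Y|, ← h4, ← abs_mul, ← h5]
  rfl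

theorem rowDet_smul {k : ℕ} (r : ℝ) (Y : Fin k → Rn k) :
    rowDet (fun i => r • Y i) = r ^ k * rowDet Y := by
  have h := Matrix.det_smul (Matrix.of fun i l => Y i l) r
  rw [Fintype.card_fin] at h
  exact h

theorem ofReal_abs_rowDet_of_triangular {k : ℕ} {T : Fin k → Rn k}
    (h : ∀ i l : Fin k, i.val < l.val → T i l = 0)
    (hpos : ∀ i l : Fin k, l.val = i.val → 0 < T i l) :
    ENNReal.ofReal |rowDet T| = diagProd le_rfl T := by
  rw [rowDet, Matrix.det_of_isLowerTriangular]
  · simp only [Matrix.of_apply]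
    rw [abs_of_nonneg (Finset.prod_nonneg fun i _ => (hpos i i rfl).le),
      ENNReal.ofReal_prod_of_nonneg fun i _ => (hpos i i rfl).le]
    rfl
  · intro i j hij
    exact h i j (by simpa using hij)

/-- The total mass of the Grassmannian is the quotient of the constants that the Gram–Schmidt
decomposition produces in `ℝⁿ` and in `ℝᵏ`. -/
theorem ofReal_mass_mul_prod_sphereArea {k n : ℕ} (hkn : k ≤ n) :
    ENNReal.ofReal (LGrass.mass k n) * ∏ i ∈ Finset.range k, ENNReal.ofReal (sphereArea (k - i)) =
      ∏ i ∈ Finset.range k, ENNReal.ofReal (sphereArea (n - i)) := by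
  have hpos : ∀ m, k ≤ m → ∀ i ∈ Finset.range k, 0 < sphereArea (m - i) := fun m hm i hi =>
    sphereArea_pos (by have := Finset.mem_range.1 hi; omega)
  have hpos' : ∀ i ∈ Finset.range k, 0 < sphereArea (i + 1) := fun i _ => sphereArea_pos (by omega)
  have hrefl : ∏ i ∈ Finset.range k, sphereArea (k - i) =
      ∏ i ∈ Finset.range k, sphereArea (i + 1) := by
    rw [← Finset.prod_range_reflect]
    refine Finset.prod_congr rfl fun i hi => ?_
    congr 1
    have := Finset.mem_range.1 hi
    omega
  rw [← ENNReal.ofReal_prod_of_nonneg fun i hi => (hpos k le_rfl i hi).le,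
    ← ENNReal.ofReal_prod_of_nonneg fun i hi => (hpos n hkn i hi).le, hrefl,
    ← ENNReal.ofReal_mul, LGrass.mass, div_mul_cancel₀ _ (Finset.prod_pos hpos').ne']
  exact div_nonneg (Finset.prod_nonneg fun i hi => (hpos n hkn i hi).le) (Finset.prod_pos hpos').le

/-- Every isometric copy of `ℝᵏ` in `ℝⁿ` is a rotation of the coordinate plane. -/
theorem exists_isometry_extending {k n : ℕ} (hkn : k ≤ n) (T : Rn k →ₗᵢ[ℝ] Rn n) :
    ∃ a : Rn n ≃ₗᵢ[ℝ] Rn n, ∀ v, a (coordIncl hkn v) = T v := by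
  let e := (coordIncl hkn).equivRange
  let S : LinearMap.range (coordIncl hkn).toLinearMap →ₗᵢ[ℝ] Rn n :=
    T.comp e.symm.toLinearIsometry
  refine ⟨S.extend.toLinearIsometryEquiv rfl, fun v => ?_⟩
  have h := S.extend_apply (e v)
  have h2 : S (e v) = T v := by
    change T (e.symm (e v)) = _
    rw [e.symm_apply_apply]
  rw [← h2, ← h]
  rfl

/-- The **linear Blaschke–Petkantschin formula**: `k` vectors of `ℝⁿ` can be produced by choosing
`k` vectors in a fixed `k`-plane, with density the power `n - k` of their determinant, and applying
a Haar distributed rotation. -/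
theorem lintegral_eq_lintegral_rotate {k n : ℕ} (hkn : k ≤ n)
    {H : (Fin k → Rn n) → ℝ≥0∞} (hH : Measurable H) :
    ∫⁻ y, H y = ENNReal.ofReal (LGrass.mass k n) * ∫⁻ g, (∫⁻ Y : Fin k → Rn k,
      H (fun i => (g : Rn n →L[ℝ] Rn n) (coordIncl hkn (Y i))) *
        ENNReal.ofReal |rowDet Y| ^ (n - k)) ∂(OrthGroup.haarProb (Rn n)) := by
  have hι := (coordIncl hkn).continuous.measurable
  have hact : ∀ {m : ℕ} {α : Type} [MeasurableSpace α] {f : α → OrthGroup (Rn m)} {v : α → Rn m},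
      Measurable f → Measurable v → Measurable fun p => (f p : Rn m →L[ℝ] Rn m) (v p) :=
    fun hf hv => OrthGroup.measurable_apply.comp (hf.prodMk hv)
  set C := ∏ i ∈ Finset.range k, ENNReal.ofReal (sphereArea (k - i))
  have hdet : ∀ (g : OrthGroup (Rn k)) (T : Fin k → Rn k),
      |rowDet fun i => (g : Rn k →L[ℝ] Rn k) (T i)| = |rowDet T| :=
    fun g T => abs_rowDet_isometry (Unitary.linearIsometryEquiv g) T
  -- Gram–Schmidt in `ℝᵏ` for fixed `g`
  have h1 : ∀ g : OrthGroup (Rn n), ∫⁻ Y : Fin k → Rn k,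
      H (fun i => (g : Rn n →L[ℝ] Rn n) (coordIncl hkn (Y i))) *
        ENNReal.ofReal |rowDet Y| ^ (n - k) =
      C * ∫⁻ g', ∫⁻ T,
        H (fun i => (g : Rn n →L[ℝ] Rn n) (coordIncl hkn ((g' : Rn k →L[ℝ] Rn k) (T i)))) *
        ENNReal.ofReal |rowDet T| ^ (n - k) ∂(triMeasure k k) ∂(OrthGroup.haarProb (Rn k)) := by
    intro g
    have h := lintegral_eq_lintegral_triMeasure (le_refl k) (le_refl k)
      (H := fun Y => H (fun i => (g : Rn n →L[ℝ] Rn n) (coordIncl hkn (Y i))) *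
        ENNReal.ofReal |rowDet Y| ^ (n - k)) (by fun_prop)
    simpa only [coordIncl_self, hdet, Nat.sub_self, pow_zero, mul_one] using h
  simp only [h1]
  have hm : Measurable fun p : (OrthGroup (Rn n) × OrthGroup (Rn k)) × (Fin k → Rn k) =>
      H (fun i => (p.1.1 : Rn n →L[ℝ] Rn n) (coordIncl hkn ((p.1.2 : Rn k →L[ℝ] Rn k) (p.2 i)))) *
        ENNReal.ofReal |rowDet p.2| ^ (n - k) := by
    refine Measurable.mul (hH.comp (measurable_pi_lambda _ fun i => ?_)) (by fun_prop)
    exact hact (by fun_prop) (hι.comp (hact (by fun_prop) (by fun_prop)))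
  have hCtop : C ≠ ∞ := ENNReal.prod_ne_top fun _ _ => ENNReal.ofReal_ne_top
  rw [lintegral_const_mul' _ _ hCtop, ← mul_assoc, ofReal_mass_mul_prod_sphereArea hkn,
    lintegral_lintegral_swap hm.lintegral_prod_right'.aemeasurable,
    lintegral_eq_lintegral_triMeasure hkn le_rfl hH]
  congr 1
  -- the rotation of `ℝᵏ` is absorbed by the right invariance of Haar measure
  have h2 : ∀ g' : OrthGroup (Rn k), ∫⁻ g, ∫⁻ T,
      H (fun i => (g : Rn n →L[ℝ] Rn n) (coordIncl hkn ((g' : Rn k →L[ℝ] Rn k) (T i)))) *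
        ENNReal.ofReal |rowDet T| ^ (n - k) ∂(triMeasure k k) ∂(OrthGroup.haarProb (Rn n)) =
      ∫⁻ g, ∫⁻ T, H (fun i => (g : Rn n →L[ℝ] Rn n) (coordIncl hkn (T i))) *
        ENNReal.ofReal |rowDet T| ^ (n - k) ∂(triMeasure k k) ∂(OrthGroup.haarProb (Rn n)) := by
    intro g'
    obtain ⟨a, ha⟩ := exists_isometry_extending hkn
      ((coordIncl hkn).comp (Unitary.linearIsometryEquiv g').toLinearIsometry)
    have ha' : ∀ v, coordIncl hkn ((g' : Rn k →L[ℝ] Rn k) v) = a (coordIncl hkn v) :=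
      fun v => (ha v).symm
    simp only [ha']
    have h := OrthGroup.lintegral_comp_mul_right (fun g : OrthGroup (Rn n) =>
      ∫⁻ T, H (fun i => (g : Rn n →L[ℝ] Rn n) (coordIncl hkn (T i))) *
        ENNReal.ofReal |rowDet T| ^ (n - k) ∂(triMeasure k k)) a
    simpa only [OrthGroup.mul_symm_apply] using h
  simp only [h2, lintegral_const, measure_univ, mul_one]
  refine lintegral_congr fun g => lintegral_congr_ae ?_
  filter_upwards [ae_triMeasure k k] with T hT
  rw [ofReal_abs_rowDet_of_triangular hT.1 hT.2]

theorem ae_rowDet_ne_zero (k : ℕ) : ∀ᵐ Y : Fin k → Rn k, rowDet Y ≠ 0 := by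
  have hs : MeasurableSet {Y : Fin k → Rn k | rowDet Y = 0} :=
    measurableSet_eq_fun (by fun_prop) (by fun_prop)
  have h := lintegral_eq_lintegral_triMeasure (le_refl k) (le_refl k)
    (H := {Y : Fin k → Rn k | rowDet Y = 0}.indicator 1) (measurable_one.indicator hs)
  rw [lintegral_indicator_one hs] at h
  rw [ae_iff]
  simp only [ne_eq, not_not]
  rw [h]
  refine mul_eq_zero_of_right _ ?_
  refine (lintegral_congr fun g => ?_).trans lintegral_zero
  refine (lintegral_congr_ae ?_).trans lintegral_zero
  filter_upwards [ae_triMeasure k k] with T hT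
  simp only [coordIncl_self, Nat.sub_self, pow_zero, mul_one]
  refine indicator_of_notMem ?_ _
  change ¬ rowDet (fun i => (Unitary.linearIsometryEquiv g) (T i)) = 0
  rw [← abs_eq_zero, abs_rowDet_isometry]
  intro h0
  have h1 := ofReal_abs_rowDet_of_triangular hT.1 hT.2
  rw [h0, ENNReal.ofReal_zero, diagProd, eq_comm, Finset.prod_eq_zero_iff] at h1
  obtain ⟨i, -, hi⟩ := h1
  exact (ENNReal.ofReal_pos.2 (hT.2 i _ rfl)).ne' hi

/-! ### Product measures with densities -/

theorem lintegral_pi_finCons {β : Type*} [MeasurableSpace β] {j : ℕ} (μ : Measure β)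
    [SigmaFinite μ] {F : (Fin (j + 1) → β) → ℝ≥0∞} (hF : Measurable F) :
    ∫⁻ y, F y ∂(Measure.pi fun _ => μ) =
      ∫⁻ v, ∫⁻ y : Fin j → β, F (Fin.cons v y) ∂(Measure.pi fun _ => μ) ∂μ := by
  have h := (measurePreserving_piFinSuccAbove (fun _ : Fin (j + 1) => μ) 0).symm
  rw [← h.lintegral_comp hF, lintegral_prod _ (by fun_prop)]
  refine lintegral_congr fun y => lintegral_congr fun v => ?_
  congr 1
  exact Fin.insertNth_zero' y v

@[fun_prop]
theorem measurable_finCons {α β : Type*} [MeasurableSpace α] [MeasurableSpace β] {j : ℕ}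
    {f : α → Fin j → β} {g : α → β} (hg : Measurable g) (hf : Measurable f) :
    Measurable fun p => (Fin.cons (g p) (f p) : Fin (j + 1) → β) := by
  refine measurable_pi_lambda _ fun i => ?_
  refine Fin.cases ?_ (fun i => ?_) i
  · simpa using hg
  · simp only [Fin.cons_succ]
    exact (measurable_pi_apply i).comp hf

theorem lintegral_pi_prod {β : Type*} [MeasurableSpace β] (μ : Measure β)
    [SigmaFinite μ] : ∀ {j : ℕ} {f : Fin j → β → ℝ≥0∞}, (∀ i, Measurable (f i)) →
    ∫⁻ y : Fin j → β, ∏ i, f i (y i) ∂(Measure.pi fun _ => μ) = ∏ i, ∫⁻ v, f i v ∂μ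
  | 0, f, hf => by simp
  | j + 1, f, hf => by
    have ih := lintegral_pi_prod μ (f := fun i : Fin j => f i.succ) fun i => hf _
    rw [lintegral_pi_finCons μ (by fun_prop)]
    simp only [Fin.prod_univ_succ, Fin.cons_zero, Fin.cons_succ]
    have hm : Measurable fun y : Fin j → β => ∏ i : Fin j, f i.succ (y i) := by fun_prop
    simp only [lintegral_const_mul _ hm, ih]
    rw [lintegral_mul_const _ (hf 0)]

theorem pi_withDensity {β : Type*} [MeasurableSpace β] (μ : Measure β) [SigmaFinite μ] {j : ℕ}
    {q : β → ℝ≥0∞} (hq : Measurable q) [SigmaFinite (μ.withDensity q)] :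
    (Measure.pi fun _ : Fin j => μ.withDensity q) =
      (Measure.pi fun _ : Fin j => μ).withDensity fun x => ∏ i, q (x i) := by
  refine Measure.pi_eq fun s hs => ?_
  have h1 : ∀ x : Fin j → β, (univ.pi s).indicator (fun x => ∏ i, q (x i)) x =
      ∏ i, (s i).indicator q (x i) := by
    intro x
    by_cases hx : x ∈ univ.pi s
    · rw [indicator_of_mem hx]
      exact Finset.prod_congr rfl fun i _ => (indicator_of_mem (hx i (mem_univ i)) _).symm
    · rw [indicator_of_notMem hx]
      simp only [mem_univ_pi, not_forall] at hx
      obtain ⟨i, hi⟩ := hx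
      exact (Finset.prod_eq_zero (Finset.mem_univ i) (indicator_of_notMem hi _)).symm
  rw [withDensity_apply _ (MeasurableSet.univ_pi hs),
    ← lintegral_indicator (MeasurableSet.univ_pi hs)]
  simp only [h1]
  rw [lintegral_pi_prod μ fun i => hq.indicator (hs i)]
  refine Finset.prod_congr rfl fun i _ => ?_
  rw [lintegral_indicator (hs i), withDensity_apply _ (hs i)]

/-! ### Polar coordinates in the squared radius -/

/-- Lebesgue measure in polar coordinates, expressed through the amount `w = ‖y‖² - c` by which the
squared radius exceeds a constant `c`. The density vanishes for `w ≤ -c`, where `√(c + w)` and its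
inverse take the value zero. -/
noncomputable def sqRadiusDensity (k : ℕ) (c w : ℝ) : ℝ≥0∞ :=
  ENNReal.ofReal (√(c + w) ^ (k - 1) * (2 * √(c + w))⁻¹)

@[fun_prop]
theorem measurable_sqRadiusDensity (k : ℕ) (c : ℝ) : Measurable (sqRadiusDensity k c) := by
  unfold sqRadiusDensity
  fun_prop

theorem sqRadiusDensity_eq_zero {k : ℕ} {c w : ℝ} (h : w ≤ -c) : sqRadiusDensity k c w = 0 := by
  rw [sqRadiusDensity, Real.sqrt_eq_zero_of_nonpos (by linarith)]
  simp

theorem setLIntegral_Ioi_eq_lintegral_sqRadiusDensity (k : ℕ) (c : ℝ) (F : ℝ → ℝ≥0∞) :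
    ∫⁻ r in Ioi (0 : ℝ), ENNReal.ofReal (r ^ (k - 1)) * F r =
      ∫⁻ w : ℝ, sqRadiusDensity k c w * F √(c + w) := by
  have himage : (fun w => √(c + w)) '' Ioi (-c) = Ioi 0 := by
    ext r
    simp only [mem_image, mem_Ioi]
    constructor
    · rintro ⟨w, hw, rfl⟩
      exact Real.sqrt_pos.2 (by linarith)
    · intro hr
      exact ⟨r ^ 2 - c, by nlinarith, by rw [add_sub_cancel, Real.sqrt_sq hr.le]⟩
  have hderiv : ∀ w ∈ Ioi (-c), HasDerivWithinAt (fun w => √(c + w)) (1 / (2 * √(c + w)))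
      (Ioi (-c)) w := by
    intro w hw
    have hw' : -c < w := hw
    have := ((hasDerivAt_id w).const_add c).sqrt (by simp only [id]; linarith)
    exact this.hasDerivWithinAt
  have hinj : InjOn (fun w => √(c + w)) (Ioi (-c)) := by
    intro a ha b hb hab
    have ha' : -c < a := ha
    have hb' : -c < b := hb
    have := (Real.sqrt_inj (by linarith) (by linarith)).1 hab
    linarith
  rw [← himage, lintegral_image_eq_lintegral_abs_deriv_mul measurableSet_Ioi hderiv hinj,
    ← lintegral_indicator measurableSet_Ioi]
  refine lintegral_congr fun w => ?_
  by_cases hw : w ∈ Ioi (-c)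
  · rw [indicator_of_mem hw, sqRadiusDensity, abs_of_nonneg (by positivity), ← mul_assoc,
      ← ENNReal.ofReal_mul (by positivity), one_div, mul_comm (2 * √(c + w))⁻¹]
  · rw [indicator_of_notMem hw, sqRadiusDensity_eq_zero (not_lt.1 hw), zero_mul]

section Points

variable {k : ℕ}

/-- The surface measure of the unit sphere of `ℝᵏ`. -/
noncomputable abbrev sphereVol (k : ℕ) : Measure (Metric.sphere (0 : Rn k) 1) :=
  (volume : Measure (Rn k)).toSphere

theorem measurePreserving_sqRadius (hk : 0 < k) (c : ℝ) :
    MeasurePreserving (fun p : Metric.sphere (0 : Rn k) 1 × ℝ => √(c + p.2) • (p.1 : Rn k))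
      ((sphereVol k).prod (volume.withDensity (sqRadiusDensity k c))) volume := by
  have : Nonempty (Fin k) := ⟨⟨0, hk⟩⟩
  have hm : Measurable fun p : Metric.sphere (0 : Rn k) 1 × ℝ => √(c + p.2) • (p.1 : Rn k) := by
    fun_prop
  refine ⟨hm, Measure.ext_of_lintegral _ fun F hF => ?_⟩
  rw [lintegral_map hF hm, lintegral_prod _ (by fun_prop),
    lintegral_eq_lintegral_toSphere volume hF]
  refine lintegral_congr fun u => ?_
  rw [lintegral_withDensity_eq_lintegral_mul _ (by fun_prop) (by fun_prop),
    finrank_euclideanSpace, Fintype.card_fin,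
    setLIntegral_Ioi_eq_lintegral_sqRadiusDensity k c fun r => F (r • (u : Rn k))]
  rfl

theorem lintegral_pi_eq_lintegral_sqRadius (hk : 0 < k) (c : ℝ) {j : ℕ}
    {F : (Fin j → Rn k) → ℝ≥0∞} (hF : Measurable F) :
    ∫⁻ y, F y = ∫⁻ u : Fin j → Metric.sphere (0 : Rn k) 1, (∫⁻ w : Fin j → ℝ,
      (∏ i, sqRadiusDensity k c (w i)) * F (fun i => √(c + w i) • (u i : Rn k)))
        ∂(Measure.pi fun _ => sphereVol k) := by
  have hσ : SigmaFinite (volume.withDensity (sqRadiusDensity k c)) := by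
    unfold sqRadiusDensity
    exact SigmaFinite.withDensity_ofReal _
  have h1 := measurePreserving_pi (fun _ : Fin j =>
      (sphereVol k).prod (volume.withDensity (sqRadiusDensity k c))) (fun _ => volume)
    fun _ => measurePreserving_sqRadius hk c
  have h2 := (measurePreserving_arrowProdEquivProdArrow (Metric.sphere (0 : Rn k) 1) ℝ (Fin j)
    (fun _ => sphereVol k) (fun _ => volume.withDensity (sqRadiusDensity k c))).symm
  have h3 : MeasurePreserving (fun (p : (Fin j → Metric.sphere (0 : Rn k) 1) × (Fin j → ℝ)) i =>
      √(c + p.2 i) • (p.1 i : Rn k)) _ _ := h1.comp h2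
  rw [volume_pi, ← h3.lintegral_comp hF, pi_withDensity volume (measurable_sqRadiusDensity k c),
    lintegral_prod _ (by fun_prop)]
  refine lintegral_congr fun u => ?_
  rw [lintegral_withDensity_eq_lintegral_mul _ (by fun_prop) (by fun_prop)]
  rfl

end Points

/-! ### Circumcentres -/

section Circumcentre

variable {k : ℕ}

/-- The edge vectors `yᵢ - y₀` of a simplex. -/
noncomputable def edges {V : Type*} [AddCommGroup V] (y : Fin (k + 1) → V) : Fin k → V :=
  fun i => y i.succ - y 0

@[fun_prop]
theorem continuous_edges : Continuous (edges : (Fin (k + 1) → Rn k) → Fin k → Rn k) := by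
  unfold edges
  fun_prop

@[fun_prop]
theorem measurable_edges : Measurable (edges : (Fin (k + 1) → Rn k) → Fin k → Rn k) :=
  continuous_edges.measurable

/-- The amounts `‖yᵢ‖² - ‖y₀‖²` by which the squared radii of `y₁, …, yₖ` exceed that of `y₀`. -/
noncomputable def sqExcess (y : Fin (k + 1) → Rn k) : Fin k → ℝ :=
  fun i => ‖y i.succ‖ ^ 2 - ‖y 0‖ ^ 2

@[fun_prop]
theorem measurable_sqExcess : Measurable (sqExcess (k := k)) := by
  unfold sqExcess
  fun_prop

/-- The matrix with rows `2 Yᵢ`. -/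
noncomputable def doubledMatrix (Y : Fin k → Rn k) : Matrix (Fin k) (Fin k) ℝ :=
  Matrix.of fun i l => 2 * Y i l

/-- The point `c` for which the points `c, c + Y₁, …, c + Yₖ` have squared norms exceeding `‖c‖²` by
`w₁, …, wₖ`. It solves the linear system `2 ⟪Yᵢ, c⟫ = wᵢ - ‖Yᵢ‖²`, and has this meaning only for
linearly independent `Y`. -/
noncomputable def offset (Y : Fin k → Rn k) (w : Fin k → ℝ) : Rn k :=
  WithLp.toLp 2 ((doubledMatrix Y)⁻¹.mulVec fun i => w i - ‖Y i‖ ^ 2)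

/-- The simplex with edges `Y` placed so that its squared radii differ by `w`. For `w = 0` its
circumcentre is the origin. -/
noncomputable def centred (Y : Fin k → Rn k) (w : Fin k → ℝ) : Fin (k + 1) → Rn k :=
  Fin.cons (offset Y w) fun i => offset Y w + Y i

theorem edges_cons (v : Rn k) (Y : Fin k → Rn k) :
    edges (Fin.cons v fun i => v + Y i : Fin (k + 1) → Rn k) = Y := by
  ext1 i
  simp [edges]

theorem sqExcess_cons (v : Rn k) (Y : Fin k → Rn k) :
    sqExcess (Fin.cons v fun i => v + Y i : Fin (k + 1) → Rn k) =
      fun i => (doubledMatrix Y).mulVec v.ofLp i + ‖Y i‖ ^ 2 := by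
  ext1 i
  have h : (doubledMatrix Y).mulVec v.ofLp i = 2 * inner ℝ v (Y i) := by
    simp [doubledMatrix, Matrix.mulVec, dotProduct, PiLp.inner_apply, Finset.mul_sum, mul_assoc]
  simp only [sqExcess, Fin.cons_succ, Fin.cons_zero, h]
  rw [norm_add_sq_real]
  ring

theorem det_doubledMatrix (Y : Fin k → Rn k) :
    (doubledMatrix Y).det = 2 ^ k * rowDet Y := by
  have h := Matrix.det_smul (Matrix.of fun i l => Y i l) (2 : ℝ)
  rw [Fintype.card_fin] at h
  exact h

theorem sqExcess_centred {Y : Fin k → Rn k} (hY : rowDet Y ≠ 0) (w : Fin k → ℝ) :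
    sqExcess (centred Y w) = w := by
  rw [centred, sqExcess_cons]
  ext1 i
  simp only [offset]
  rw [Matrix.mulVec_mulVec, Matrix.mul_nonsing_inv _ (by
    rw [det_doubledMatrix]; exact (mul_ne_zero (by positivity) hY).isUnit), Matrix.one_mulVec]
  ring

theorem continuous_doubledMatrix : Continuous (doubledMatrix (k := k)) := by
  refine continuous_matrix fun i j => ?_
  simp only [doubledMatrix, Matrix.of_apply]
  fun_prop

theorem measurable_doubledMatrix_inv_apply (i j : Fin k) :
    Measurable fun Y : Fin k → Rn k => (doubledMatrix Y)⁻¹ i j := by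
  have hM := continuous_doubledMatrix (k := k)
  simp only [Matrix.inv_def, Ring.inverse_eq_inv', Matrix.smul_apply, smul_eq_mul]
  exact (hM.matrix_det.measurable.inv).mul (hM.matrix_adjugate.matrix_elem i j).measurable

@[fun_prop]
theorem measurable_offset {α : Type*} [MeasurableSpace α] {f : α → Fin k → Rn k}
    {g : α → Fin k → ℝ} (hf : Measurable f) (hg : Measurable g) :
    Measurable fun p => offset (f p) (g p) := by
  refine (WithLp.measurable_toLp 2 _).comp (measurable_pi_lambda _ fun i => ?_)
  simp only [Matrix.mulVec, dotProduct]
  refine Finset.measurable_fun_sum _ fun j _ => Measurable.mul ?_ (by fun_prop)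
  exact (measurable_doubledMatrix_inv_apply i j).comp hf

@[fun_prop]
theorem measurable_centred {α : Type*} [MeasurableSpace α] {f : α → Fin k → Rn k}
    {g : α → Fin k → ℝ} (hf : Measurable f) (hg : Measurable g) :
    Measurable fun p => centred (f p) (g p) := by
  unfold centred
  fun_prop

theorem continuous_offset (Y : Fin k → Rn k) : Continuous (offset Y) := by
  unfold offset
  refine (PiLp.continuous_toLp 2 _).comp ?_
  exact Continuous.matrix_mulVec continuous_const (by fun_prop)

theorem continuous_centred (Y : Fin k → Rn k) : Continuous (centred Y) := by
  have := continuous_offset Y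
  refine continuous_pi fun i => ?_
  refine Fin.cases ?_ (fun i => ?_) i <;> simp only [centred, Fin.cons_zero, Fin.cons_succ] <;>
    fun_prop

/-- For fixed edges `Y`, the position of the simplex is an affine function of its squared radius
excesses `w`. -/
theorem lintegral_offset {Y : Fin k → Rn k} (hY : rowDet Y ≠ 0)
    {F : Rn k → ℝ≥0∞} (hF : Measurable F) :
    ∫⁻ w, F (offset Y w) = ENNReal.ofReal (2 ^ k * |rowDet Y|) * ∫⁻ v, F v := by
  set M := doubledMatrix Y
  have hdet : M.det = 2 ^ k * rowDet Y := det_doubledMatrix Y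
  have hdet0 : M.det ≠ 0 := by
    rw [hdet]
    exact mul_ne_zero (by positivity) hY
  have hdet' : M⁻¹.det ≠ 0 := by
    rw [Matrix.det_nonsing_inv, Ring.inverse_eq_inv']
    exact inv_ne_zero hdet0
  have h1 := Real.map_matrix_volume_pi_eq_smul_volume_pi hdet'
  rw [Matrix.det_nonsing_inv, Ring.inverse_eq_inv', inv_inv, hdet, abs_mul,
    abs_of_pos (by positivity : (0 : ℝ) < 2 ^ k)] at h1
  have hmul : Measurable (Matrix.toLin' M⁻¹) :=
    (LinearMap.continuous_of_finiteDimensional _).measurable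
  have hF' : Measurable fun x : Fin k → ℝ => F (WithLp.toLp 2 x) := by fun_prop
  calc ∫⁻ w, F (offset Y w)
      = ∫⁻ w : Fin k → ℝ, F (WithLp.toLp 2 (Matrix.toLin' M⁻¹ (w - fun i => ‖Y i‖ ^ 2))) := rfl
    _ = ∫⁻ w : Fin k → ℝ, F (WithLp.toLp 2 (Matrix.toLin' M⁻¹ w)) :=
        lintegral_sub_right_eq_self
          (fun w : Fin k → ℝ => F (WithLp.toLp 2 (Matrix.toLin' M⁻¹ w))) _
    _ = ∫⁻ x, F (WithLp.toLp 2 x) ∂(volume.map (Matrix.toLin' M⁻¹)) :=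
        (lintegral_map hF' hmul).symm
    _ = _ := by
        rw [h1, lintegral_smul_measure, smul_eq_mul,
          (PiLp.volume_preserving_toLp (Fin k)).lintegral_comp hF]

/-- The change of variables replacing the position of a simplex with given edges by its squared
radius differences. -/
theorem lintegral_lintegral_centred {H : (Fin (k + 1) → Rn k) → ℝ≥0∞} (hH : Measurable H)
    {G : (Fin k → ℝ) → ℝ≥0∞} (hG : Measurable G) :
    ∫⁻ w, G w * ∫⁻ Y, H (centred Y w) =
      ∫⁻ y, ENNReal.ofReal (2 ^ k * |rowDet (edges y)|) * (H y * G (sqExcess y)) := by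
  have hm : Measurable fun p : Rn k × (Fin k → Rn k) =>
      (Fin.cons p.1 fun i => p.1 + p.2 i : Fin (k + 1) → Rn k) := by fun_prop
  calc ∫⁻ w, G w * ∫⁻ Y, H (centred Y w)
      = ∫⁻ w, ∫⁻ Y, G w * H (centred Y w) := by
        refine lintegral_congr fun w => (lintegral_const_mul _ ?_).symm
        fun_prop
    _ = ∫⁻ Y, ∫⁻ w, G w * H (centred Y w) := by
        have hm' : Measurable fun p : (Fin k → ℝ) × (Fin k → Rn k) =>
            G p.1 * H (centred p.2 p.1) := by fun_prop
        exact lintegral_lintegral_swap hm'.aemeasurable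
    _ = ∫⁻ Y : Fin k → Rn k, ∫⁻ v : Rn k, ENNReal.ofReal (2 ^ k * |rowDet Y|) *
          (H (Fin.cons v fun i => v + Y i) * G (sqExcess (Fin.cons v fun i => v + Y i))) := by
        refine lintegral_congr_ae ?_
        filter_upwards [ae_rowDet_ne_zero k] with Y hY
        have hmY : Measurable fun v : Rn k =>
            (Fin.cons v fun i => v + Y i : Fin (k + 1) → Rn k) := by fun_prop
        rw [lintegral_const_mul _ (by fun_prop), ← lintegral_offset hY (by fun_prop)]
        refine lintegral_congr fun w => ?_
        have h := sqExcess_centred hY w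
        rw [centred] at h
        rw [h, mul_comm, centred]
    _ = ∫⁻ v : Rn k, ∫⁻ Y : Fin k → Rn k, ENNReal.ofReal (2 ^ k * |rowDet Y|) *
          (H (Fin.cons v fun i => v + Y i) * G (sqExcess (Fin.cons v fun i => v + Y i))) := by
        rw [lintegral_lintegral_swap]
        fun_prop
    _ = _ := by
        refine Eq.trans ?_ (lintegral_pi_finCons (volume : Measure (Rn k))
          (F := fun y => ENNReal.ofReal (2 ^ k * |rowDet (edges y)|) * (H y * G (sqExcess y)))
          (by fun_prop)).symm
        refine lintegral_congr fun v => ?_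
        rw [← volume_pi]
        refine Eq.trans ?_ (lintegral_add_left_eq_self _ (fun _ : Fin k => v))
        refine lintegral_congr fun Y => ?_
        have : (Fin.cons v ((fun _ => v) + Y) : Fin (k + 1) → Rn k) =
          Fin.cons v fun i => v + Y i := rfl
        rw [this, edges_cons]

end Circumcentre

/-! ### Simplices inscribed in nearly concentric spheres -/

section Inscribed

variable {k : ℕ}

/-- The parameters `(u₀, r, (u₁, …, uₖ))` of a simplex inscribed in a sphere around the origin, with
the product of surface measures and Lebesgue measure on `r > 0`. -/
noncomputable abbrev inscribedMeasure (k : ℕ) :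
    Measure (Metric.sphere (0 : Rn k) 1 × (ℝ × (Fin k → Metric.sphere (0 : Rn k) 1))) :=
  (sphereVol k).prod ((volume.restrict (Ioi 0)).prod (Measure.pi fun _ => sphereVol k))

instance : SFinite (inscribedMeasure k) :=
  @Measure.prod.instSFinite _ _ _ _ _ _ _ (@Measure.prod.instSFinite _ _ _ _ _ _ _ _)

/-- The simplex with vertices in the directions `u₀, …, uₖ`, whose zeroth vertex has norm `r` and
whose `i`-th vertex has squared norm `r² + wᵢ`. -/
noncomputable def placed
    (p : Metric.sphere (0 : Rn k) 1 × (ℝ × (Fin k → Metric.sphere (0 : Rn k) 1)))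
    (w : Fin k → ℝ) : Fin (k + 1) → Rn k :=
  Fin.cons (p.2.1 • (p.1 : Rn k)) fun i => √(p.2.1 ^ 2 + w i) • (p.2.2 i : Rn k)

@[fun_prop]
theorem measurable_placed {α : Type*} [MeasurableSpace α]
    {f : α → Metric.sphere (0 : Rn k) 1 × (ℝ × (Fin k → Metric.sphere (0 : Rn k) 1))}
    {g : α → Fin k → ℝ} (hf : Measurable f) (hg : Measurable g) :
    Measurable fun p => placed (f p) (g p) := by
  unfold placed
  fun_prop

theorem continuous_placed
    (p : Metric.sphere (0 : Rn k) 1 × (ℝ × (Fin k → Metric.sphere (0 : Rn k) 1))) :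
    Continuous (placed p) := by
  refine continuous_pi fun i => ?_
  refine Fin.cases ?_ (fun i => ?_) i <;> simp only [placed, Fin.cons_zero, Fin.cons_succ] <;>
    fun_prop

theorem norm_placed_zero
    (p : Metric.sphere (0 : Rn k) 1 × (ℝ × (Fin k → Metric.sphere (0 : Rn k) 1)))
    (w : Fin k → ℝ) : ‖placed p w 0‖ = |p.2.1| := by
  simp [placed, norm_smul]

theorem norm_placed_succ
    (p : Metric.sphere (0 : Rn k) 1 × (ℝ × (Fin k → Metric.sphere (0 : Rn k) 1)))
    (w : Fin k → ℝ) (i : Fin k) : ‖placed p w i.succ‖ = √(p.2.1 ^ 2 + w i) := by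
  simp [placed, norm_smul]

/-- The weight which Lebesgue measure receives in the parameters of `placed`, up to the factor
`∏ ‖yᵢ‖` over `i ≥ 1` that is included in the test function. -/
noncomputable def inscribedWeight (y : Fin (k + 1) → Rn k) : ℝ :=
  |rowDet (edges y)| * ∏ i, ‖y i‖ ^ (k - 1)

@[fun_prop]
theorem continuous_inscribedWeight : Continuous (inscribedWeight (k := k)) := by
  unfold inscribedWeight
  fun_prop

theorem lintegral_inscribedMeasure
    {F : Metric.sphere (0 : Rn k) 1 × (ℝ × (Fin k → Metric.sphere (0 : Rn k) 1)) → ℝ≥0∞}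
    (hF : Measurable F) :
    ∫⁻ p, F p ∂(inscribedMeasure k) = ∫⁻ u₀, (∫⁻ r in Ioi (0 : ℝ), (∫⁻ u, F (u₀, r, u)
      ∂(Measure.pi fun _ => sphereVol k))) ∂(sphereVol k) := by
  rw [lintegral_prod _ hF.aemeasurable]
  refine lintegral_congr fun u₀ => ?_
  rw [lintegral_prod _ (by fun_prop)]

/-- The same integral over simplices as in `lintegral_lintegral_centred`, disintegrated over the
squared radius excesses `w` by means of polar coordinates of the vertices. The hypothesis on the
support of `G` excludes the excesses `w` for which `√(r² + wᵢ)` is a junk value. -/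
theorem lintegral_placed (hk : 0 < k) {h : (Fin (k + 1) → Rn k) → ℝ} (hh : Measurable h)
    {G : (Fin k → ℝ) → ℝ≥0∞} (hG : Measurable G)
    (hsupp : ∀ w, G w ≠ 0 → ∀ i, 0 < w i) :
    ∫⁻ y, ENNReal.ofReal (2 ^ k * |rowDet (edges y)|) *
        (ENNReal.ofReal (h y * ∏ i : Fin k, ‖y i.succ‖) * G (sqExcess y)) =
      ∫⁻ w, G w * ∫⁻ p, ENNReal.ofReal (h (placed p w) * inscribedWeight (placed p w))
        ∂(inscribedMeasure k) := by
  have : Nonempty (Fin k) := ⟨⟨0, hk⟩⟩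
  have hweight := (continuous_inscribedWeight (k := k)).measurable
  have hm : Measurable fun y => ENNReal.ofReal (2 ^ k * |rowDet (edges y)|) *
        (ENNReal.ofReal (h y * ∏ i : Fin k, ‖y i.succ‖) * G (sqExcess y)) := by fun_prop
  set F := fun y : Fin (k + 1) → Rn k => ENNReal.ofReal (2 ^ k * |rowDet (edges y)|) *
        (ENNReal.ofReal (h y * ∏ i : Fin k, ‖y i.succ‖) * G (sqExcess y)) with hF
  have hm2 : ∀ v : Rn k, Measurable fun y : Fin k → Rn k => F (Fin.cons v y) :=
    fun v => hm.comp (by fun_prop)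
  -- the Jacobians cancel
  have key : ∀ (u₀ : Metric.sphere (0 : Rn k) 1) (r : ℝ), 0 < r →
      ∀ (u : Fin k → Metric.sphere (0 : Rn k) 1) (w : Fin k → ℝ),
      ENNReal.ofReal (r ^ (k - 1)) *
        ((∏ i, sqRadiusDensity k (r ^ 2) (w i)) * F (placed (u₀, r, u) w)) =
      G w * ENNReal.ofReal (h (placed (u₀, r, u) w) *
        inscribedWeight (placed (u₀, r, u) w)) := by
    intro u₀ r hr u w
    by_cases hw : ∀ i, -(r ^ 2) < w i
    · have hex : sqExcess (placed (u₀, r, u) w) = w := by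
        ext1 i
        rw [sqExcess, norm_placed_succ, norm_placed_zero, sq_abs,
          Real.sq_sqrt (by linarith [hw i])]
        simp
      by_cases hGw : G w = 0
      · simp only [hF, hex, hGw, mul_zero, zero_mul]
      · have hs : ∀ i, 0 < √(r ^ 2 + w i) := fun i => Real.sqrt_pos.2 (by linarith [hw i])
        simp only [hF, hex, inscribedWeight, Fin.prod_univ_succ, norm_placed_zero,
          norm_placed_succ, abs_of_pos hr, sqRadiusDensity]
        set y := placed (u₀, r, u) w
        rw [← ENNReal.ofReal_prod_of_nonneg fun i _ => by have := hs i; positivity]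
        have hprod : (∏ i, (√(r ^ 2 + w i) ^ (k - 1) * (2 * √(r ^ 2 + w i))⁻¹)) * (2 ^ k *
            ∏ i, √(r ^ 2 + w i)) = ∏ i, √(r ^ 2 + w i) ^ (k - 1) := by
          have h2 : (2 : ℝ) ^ k = ∏ _i : Fin k, 2 := by simp
          rw [h2, ← Finset.prod_mul_distrib, ← Finset.prod_mul_distrib]
          refine Finset.prod_congr rfl fun i _ => ?_
          have := (hs i).ne'
          field_simp
        have hp1 : 0 ≤ ∏ i, (√(r ^ 2 + w i) ^ (k - 1) * (2 * √(r ^ 2 + w i))⁻¹) :=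
          Finset.prod_nonneg fun i _ => by have := hs i; positivity
        rw [← mul_assoc, ← mul_assoc, ← mul_assoc, ← ENNReal.ofReal_mul (by positivity),
          ← ENNReal.ofReal_mul (by positivity), ← ENNReal.ofReal_mul (by positivity), mul_comm,
          ← hprod]
        congr 2
        ring
    · push Not at hw
      obtain ⟨i, hi⟩ := hw
      have h1 : G w = 0 := by
        by_contra hne
        have := hsupp w hne i
        nlinarith
      rw [h1, Finset.prod_eq_zero (Finset.mem_univ i) (sqRadiusDensity_eq_zero hi)]
      simp
  have hm3 : Measurable fun q : (Metric.sphere (0 : Rn k) 1 × (ℝ ×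
      (Fin k → Metric.sphere (0 : Rn k) 1))) × (Fin k → ℝ) => G q.2 *
      ENNReal.ofReal (h (placed q.1 q.2) * inscribedWeight (placed q.1 q.2)) := by fun_prop
  calc ∫⁻ y, F y = ∫⁻ v : Rn k, ∫⁻ y : Fin k → Rn k, F (Fin.cons v y) :=
        lintegral_pi_finCons (volume : Measure (Rn k)) hm
    _ = ∫⁻ u₀, (∫⁻ r in Ioi (0 : ℝ), ENNReal.ofReal (r ^ (k - 1)) *
          ∫⁻ y : Fin k → Rn k, F (Fin.cons (r • (u₀ : Rn k)) y)) ∂(sphereVol k) := by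
        have hm4 : Measurable fun v : Rn k => ∫⁻ y : Fin k → Rn k, F (Fin.cons v y) :=
          Measurable.lintegral_prod_right' (f := fun q : Rn k × (Fin k → Rn k) =>
            F (Fin.cons q.1 q.2)) (hm.comp (by fun_prop))
        rw [lintegral_eq_lintegral_toSphere volume hm4, finrank_euclideanSpace, Fintype.card_fin]
    _ = ∫⁻ u₀, (∫⁻ r in Ioi (0 : ℝ), (∫⁻ u, (∫⁻ w, G w * ENNReal.ofReal
          (h (placed (u₀, r, u) w) * inscribedWeight (placed (u₀, r, u) w)))
          ∂(Measure.pi fun _ => sphereVol k))) ∂(sphereVol k) := by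
        refine lintegral_congr fun u₀ => setLIntegral_congr_fun measurableSet_Ioi fun r hr => ?_
        rw [lintegral_pi_eq_lintegral_sqRadius hk (r ^ 2) (hm2 _),
          ← lintegral_const_mul' _ _ ENNReal.ofReal_ne_top]
        refine lintegral_congr fun u => ?_
        rw [← lintegral_const_mul' _ _ ENNReal.ofReal_ne_top]
        exact lintegral_congr fun w => key u₀ r hr u w
    _ = ∫⁻ p, (∫⁻ w, G w * ENNReal.ofReal (h (placed p w) * inscribedWeight (placed p w)))
          ∂(inscribedMeasure k) := (lintegral_inscribedMeasure hm3.lintegral_prod_right').symm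
    _ = ∫⁻ w, ∫⁻ p, G w * ENNReal.ofReal (h (placed p w) * inscribedWeight (placed p w))
          ∂(inscribedMeasure k) := lintegral_lintegral_swap hm3.aemeasurable
    _ = _ := by
        refine lintegral_congr fun w => lintegral_const_mul _ (by fun_prop)

/-- Two ways of averaging over pairs of a simplex `y` and its squared radius excesses `w` coincide
for almost all `w`; continuity in `w` gives the equality at `w = 0`. -/
theorem lintegral_centred_zero (hk : 0 < k) {h : (Fin (k + 1) → Rn k) → ℝ} (hh : Continuous h)
    (hc : HasCompactSupport h) :
    ∫⁻ Y, ENNReal.ofReal (h (centred Y 0) * ∏ i : Fin k, ‖centred Y 0 i.succ‖) ≠ ∞ ∧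
    ∫⁻ Y, ENNReal.ofReal (h (centred Y 0) * ∏ i : Fin k, ‖centred Y 0 i.succ‖) =
      ∫⁻ p, ENNReal.ofReal (h (placed p 0) * inscribedWeight (placed p 0))
        ∂(inscribedMeasure k) := by
  set H : (Fin (k + 1) → Rn k) → ℝ := fun y => h y * ∏ i : Fin k, ‖y i.succ‖ with hH
  set Θ : (Fin (k + 1) → Rn k) → ℝ := fun y => h y * inscribedWeight y with hΘ
  have hHc : Continuous H := by fun_prop
  have hΘc : Continuous Θ := by fun_prop
  obtain ⟨CH, hCH⟩ := (hc.mul_right (f' := fun y => ∏ i : Fin k, ‖y i.succ‖)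
    ).exists_bound_of_continuous hHc
  obtain ⟨CΘ, hCΘ⟩ := (hc.mul_right (f' := inscribedWeight)).exists_bound_of_continuous hΘc
  obtain ⟨N, hN⟩ := hc.isCompact.isBounded.exists_norm_le
  have hsmall : ∀ y, h y ≠ 0 → ∀ i, ‖y i‖ ≤ N := fun y hy i =>
    (norm_le_pi_norm y i).trans (hN y (subset_tsupport h hy))
  set box : Set (Fin k → ℝ) := univ.pi fun _ => Ioo 0 1 with hbox
  have hbox_open : IsOpen box := isOpen_set_pi finite_univ fun _ _ => isOpen_Ioo
  -- the two disintegrations as functions of `w`, which agree almost everywhere on the box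
  let A : (Fin k → ℝ) → ℝ≥0∞ := fun w => ∫⁻ Y, ENNReal.ofReal (H (centred Y w))
  let B : (Fin k → ℝ) → ℝ≥0∞ := fun w => ∫⁻ p, ENNReal.ofReal (Θ (placed p w))
    ∂(inscribedMeasure k)
  have hAm : Measurable A := Measurable.lintegral_prod_right'
    (f := fun q : (Fin k → ℝ) × (Fin k → Rn k) => ENNReal.ofReal (H (centred q.2 q.1)))
    (by fun_prop)
  have hBm : Measurable B := Measurable.lintegral_prod_right'
    (f := fun q : (Fin k → ℝ) × (Metric.sphere (0 : Rn k) 1 × (ℝ ×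
      (Fin k → Metric.sphere (0 : Rn k) 1))) => ENNReal.ofReal (Θ (placed q.2 q.1)))
    (by fun_prop)
  have hAB : A =ᵐ[volume.restrict box] B := by
    refine ae_eq_of_forall_setLIntegral_eq_of_sigmaFinite hAm hBm fun s hs _ => ?_
    rw [Measure.restrict_restrict hs]
    have hsb : MeasurableSet (s ∩ box) := hs.inter hbox_open.measurableSet
    have hG : Measurable ((s ∩ box).indicator (1 : (Fin k → ℝ) → ℝ≥0∞)) :=
      measurable_one.indicator hsb
    have h1 := lintegral_lintegral_centred (H := fun y => ENNReal.ofReal (H y)) (by fun_prop) hG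
    have h2 := lintegral_placed hk hh.measurable hG fun w hw i =>
      ((mem_of_indicator_ne_zero hw).2 i (mem_univ i)).1
    have h3 := h1.trans h2
    have hind : ∀ F : (Fin k → ℝ) → ℝ≥0∞, ∫⁻ w in s ∩ box, F w =
        ∫⁻ w, (s ∩ box).indicator 1 w * F w := fun F => by
      rw [← lintegral_indicator hsb]
      refine lintegral_congr fun w => ?_
      by_cases hw : w ∈ s ∩ box <;> simp [hw]
    rw [hind, hind]
    exact h3
  -- edges of a simplex in the ball of radius `N` have length at most `2 N`
  let bound : (Fin k → Rn k) → ℝ≥0∞ :=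
    (Metric.closedBall 0 (2 * N)).indicator fun _ => ENNReal.ofReal CH
  have hbound : ∀ w Y, ENNReal.ofReal (H (centred Y w)) ≤ bound Y := by
    intro w Y
    by_cases hy : h (centred Y w) = 0
    · simp [hH, hy]
    · have hle := hsmall _ hy
      have hN0 : 0 ≤ N := (norm_nonneg _).trans (hle 0)
      refine le_of_le_of_eq (ENNReal.ofReal_le_ofReal ((le_abs_self _).trans (hCH _)))
        (indicator_of_mem (?_ : Y ∈ Metric.closedBall 0 (2 * N)) fun _ => ENNReal.ofReal CH).symm
      rw [mem_closedBall_zero_iff, pi_norm_le_iff_of_nonneg (by positivity)]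
      intro i
      have h1 : Y i = centred Y w i.succ - centred Y w 0 := by simp [centred]
      rw [h1, two_mul]
      exact (norm_sub_le _ _).trans (add_le_add (hle _) (hle _))
  have hfin : ∫⁻ Y, bound Y ≠ ∞ := by
    rw [lintegral_indicator measurableSet_closedBall, setLIntegral_const]
    exact (ENNReal.mul_lt_top ENNReal.ofReal_lt_top measure_closedBall_lt_top).ne
  have hA0 : Filter.Tendsto A (nhds 0) (nhds (A 0)) :=
    tendsto_lintegral_filter_of_dominated_convergence bound
      (Filter.Eventually.of_forall fun w => by fun_prop)
      (Filter.Eventually.of_forall fun w => Filter.Eventually.of_forall (hbound w)) hfin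
      (Filter.Eventually.of_forall fun Y =>
        (ENNReal.continuous_ofReal.comp (hHc.comp (continuous_centred Y))).tendsto 0)
  have hB0 : Filter.Tendsto B (nhds 0) (nhds (B 0)) := by
    have hset : MeasurableSet ((univ : Set (Metric.sphere (0 : Rn k) 1)) ×ˢ (Iic N ×ˢ
        (univ : Set (Fin k → Metric.sphere (0 : Rn k) 1)))) :=
      MeasurableSet.univ.prod (measurableSet_Iic.prod MeasurableSet.univ)
    refine tendsto_lintegral_filter_of_dominated_convergence
      (((univ : Set (Metric.sphere (0 : Rn k) 1)) ×ˢ (Iic N ×ˢ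
        (univ : Set (Fin k → Metric.sphere (0 : Rn k) 1)))).indicator fun _ => ENNReal.ofReal CΘ)
      (Filter.Eventually.of_forall fun w => by fun_prop)
      (Filter.Eventually.of_forall fun w => Filter.Eventually.of_forall fun p => ?_) ?_
      (Filter.Eventually.of_forall fun p => ?_)
    · by_cases hy : h (placed p w) = 0
      · simp [hΘ, hy]
      · have hle := hsmall _ hy 0
        rw [norm_placed_zero] at hle
        rw [indicator_of_mem]
        · exact ENNReal.ofReal_le_ofReal ((le_abs_self _).trans (hCΘ _))
        · exact ⟨mem_univ _, (le_abs_self _).trans hle, mem_univ _⟩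
    · rw [lintegral_indicator hset, setLIntegral_const]
      refine (ENNReal.mul_lt_top ENNReal.ofReal_lt_top ?_).ne
      rw [Measure.prod_prod, Measure.prod_prod, Measure.restrict_apply measurableSet_Iic,
        Iic_inter_Ioi, Real.volume_Ioc]
      exact ENNReal.mul_lt_top (measure_lt_top _ _)
        (ENNReal.mul_lt_top ENNReal.ofReal_lt_top (measure_lt_top _ _))
    · exact (ENNReal.continuous_ofReal.comp (hΘc.comp (continuous_placed p))).tendsto 0
  -- an almost everywhere equality on the box holds at points arbitrarily close to its corner `0`
  have hfreq : ∃ᶠ w in nhds (0 : Fin k → ℝ), A w = B w := by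
    have hae : ∀ᵐ w, w ∈ box → A w = B w := (ae_restrict_iff' hbox_open.measurableSet).1 hAB
    have hdense : Dense {w | w ∈ box → A w = B w} := Measure.dense_of_ae hae
    have hcl : (0 : Fin k → ℝ) ∈ closure box := by
      rw [hbox, closure_pi_set]
      intro i _
      rw [closure_Ioo zero_ne_one]
      simp
    have hcl' := closure_minimal (hdense.open_subset_closure_inter hbox_open) isClosed_closure hcl
    refine (mem_closure_iff_frequently.1 hcl').mono fun w hw => hw.2 hw.1
  exact ⟨ne_top_of_le_ne_top hfin (lintegral_mono (hbound 0)),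
    tendsto_nhds_unique_of_frequently_eq hA0 hB0 hfreq⟩

end Inscribed

/-! ### The spherical Blaschke–Petkantschin formula -/

section Spherical

/-- Two measures with the same finite density `ω` agree where `ω` does not vanish. -/
theorem restrict_eq_of_withDensity_eq {α : Type*} [MeasurableSpace α] {μ ν : Measure α}
    {ω : α → ℝ≥0∞} (hω : Measurable ω) (htop : ∀ x, ω x ≠ ∞)
    (h : μ.withDensity ω = ν.withDensity ω) :
    μ.restrict {x | ω x ≠ 0} = ν.restrict {x | ω x ≠ 0} := by
  have hU : MeasurableSet {x | ω x ≠ 0} := hω (measurableSet_singleton 0).compl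
  have hinv : Measurable fun x => (ω x)⁻¹ := hω.inv
  have key : ∀ (ρ : Measure α) (s : Set α), MeasurableSet s → ρ (s ∩ {x | ω x ≠ 0}) =
      ∫⁻ x, (s ∩ {x | ω x ≠ 0}).indicator (fun x => (ω x)⁻¹) x ∂(ρ.withDensity ω) := by
    intro ρ s hs
    rw [lintegral_withDensity_eq_lintegral_mul _ hω (hinv.indicator (hs.inter hU)),
      ← lintegral_indicator_one (hs.inter hU)]
    refine lintegral_congr fun x => ?_
    by_cases hx : x ∈ s ∩ {x | ω x ≠ 0}
    · simp only [indicator_of_mem hx, Pi.mul_apply, Pi.one_apply]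
      exact (ENNReal.mul_inv_cancel hx.2 (htop x)).symm
    · simp [indicator_of_notMem hx]
  ext s hs
  rw [Measure.restrict_apply hs, Measure.restrict_apply hs, key μ s hs, key ν s hs, h]

variable {k : ℕ}

/-- The Jacobian `r ^ (k² - 1) · k! Vol(u)` of the spherical Blaschke–Petkantschin formula. -/
noncomputable def sphericalJacobian
    (p : Metric.sphere (0 : Rn k) 1 × (ℝ × (Fin k → Metric.sphere (0 : Rn k) 1))) : ℝ≥0∞ :=
  ENNReal.ofReal p.2.1 ^ (k * k - 1) *
    ENNReal.ofReal |rowDet fun i => (p.2.2 i : Rn k) - (p.1 : Rn k)|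

@[fun_prop]
theorem measurable_sphericalJacobian : Measurable (sphericalJacobian (k := k)) := by
  unfold sphericalJacobian
  fun_prop

theorem ofReal_inscribedWeight
    (p : Metric.sphere (0 : Rn k) 1 × (ℝ × (Fin k → Metric.sphere (0 : Rn k) 1)))
    (hp : 0 < p.2.1) (hk : 0 < k) :
    ENNReal.ofReal (inscribedWeight (placed p 0)) =
      sphericalJacobian p * ENNReal.ofReal (∏ i : Fin k, ‖placed p 0 i.succ‖) := by
  have hs : √(p.2.1 ^ 2) = p.2.1 := Real.sqrt_sq hp.le
  have hedges : edges (placed p 0) = fun i => p.2.1 • ((p.2.2 i : Rn k) - (p.1 : Rn k)) := by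
    ext1 i
    simp [edges, placed, smul_sub, hs]
  simp only [inscribedWeight, hedges, rowDet_smul, Fin.prod_univ_succ, norm_placed_zero,
    norm_placed_succ, Pi.zero_apply, add_zero, hs, abs_of_pos hp, Finset.prod_const,
    Finset.card_univ, Fintype.card_fin, abs_mul, abs_pow, sphericalJacobian]
  rw [← ENNReal.ofReal_pow hp.le, ← ENNReal.ofReal_mul (by positivity),
    ← ENNReal.ofReal_mul (by positivity)]
  congr 1
  obtain ⟨m, rfl⟩ : ∃ m, k = m + 1 := ⟨k - 1, by omega⟩
  have h1 : (m + 1) * (m + 1) - 1 = m + m * (m + 1) := by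
    have : (m + 1) * (m + 1) = m + m * (m + 1) + 1 := by ring
    omega
  rw [h1, Nat.add_sub_cancel]
  ring

/-- Simplices with circumcentre at the origin are described by their edges or by their circumradius
and directions. The two descriptions are compared by `lintegral_centred_zero` on the test functions
that carry a factor `∏ ‖yᵢ‖`; these determine the measures because almost no simplex has a vertex
at the origin. -/
theorem map_centred_eq_map_placed (hk : 0 < k) :
    (volume : Measure (Fin k → Rn k)).map (fun Y => centred Y 0) =
      ((inscribedMeasure k).withDensity sphericalJacobian).map fun p => placed p 0 := by
  set M₁ := (volume : Measure (Fin k → Rn k)).map fun Y => centred Y 0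
  set M₂ := ((inscribedMeasure k).withDensity sphericalJacobian).map fun p => placed p 0
  have hr : ∀ᵐ p ∂(inscribedMeasure k), 0 < p.2.1 := by
    have h1 : ∀ᵐ r ∂((volume : Measure ℝ).restrict (Ioi 0)), 0 < r :=
      ae_restrict_mem measurableSet_Ioi
    have h2 := (Measure.quasiMeasurePreserving_fst (μ := (volume : Measure ℝ).restrict (Ioi 0))
      (ν := Measure.pi fun _ : Fin k => sphereVol k)).ae h1
    exact (Measure.quasiMeasurePreserving_snd (μ := sphereVol k)
      (ν := ((volume : Measure ℝ).restrict (Ioi 0)).prod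
        (Measure.pi fun _ : Fin k => sphereVol k))).ae h2
  let prodNorm : (Fin (k + 1) → Rn k) → ℝ := fun y => ∏ i : Fin k, ‖y i.succ‖
  have hprod : Continuous prodNorm := by fun_prop
  -- test functions: continuous, compactly supported, and vanishing with one of `y₁, …, yₖ`
  have htest : ∀ h : (Fin (k + 1) → Rn k) → ℝ, Continuous h → HasCompactSupport h →
      (∀ y, 0 ≤ h y) → ∫⁻ y, ENNReal.ofReal (h y * prodNorm y) ∂M₁ ≠ ∞ ∧
        ∫⁻ y, ENNReal.ofReal (h y * prodNorm y) ∂M₁ =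
          ∫⁻ y, ENNReal.ofReal (h y * prodNorm y) ∂M₂ := by
    intro h hh hc h0
    rw [lintegral_map (by fun_prop) (by fun_prop), lintegral_map (by fun_prop) (by fun_prop),
      lintegral_withDensity_eq_lintegral_mul _ (by fun_prop) (by fun_prop)]
    obtain ⟨h1, h2⟩ := lintegral_centred_zero hk hh hc
    refine ⟨h1, h2.trans (lintegral_congr_ae ?_)⟩
    filter_upwards [hr] with p hp
    rw [Pi.mul_apply, ENNReal.ofReal_mul (h0 _), ENNReal.ofReal_mul (h0 _),
      ofReal_inscribedWeight p hp hk]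
    ring
  let cut : ℕ → (Fin (k + 1) → Rn k) → ℝ := fun N y => max 0 (N - ‖y‖)
  have hcut : ∀ N, Continuous (cut N) := fun N => by fun_prop
  have hcut0 : ∀ N y, 0 ≤ cut N y := fun N y => le_max_left _ _
  have hcutc : ∀ N, HasCompactSupport (cut N) := fun N => by
    refine HasCompactSupport.intro (isCompact_closedBall 0 (N : ℝ)) fun y hy => ?_
    rw [mem_closedBall_zero_iff, not_le] at hy
    exact max_eq_left (by linarith)
  let ω : ℕ → (Fin (k + 1) → Rn k) → ℝ≥0∞ := fun N y => ENNReal.ofReal (cut N y * prodNorm y)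
  have hω : ∀ N, Measurable (ω N) := fun N => by fun_prop
  have hdens : ∀ N, M₁.withDensity (ω N) = M₂.withDensity (ω N) := by
    intro N
    obtain ⟨hfin, heq⟩ := htest (cut N) (hcut N) (hcutc N) (hcut0 N)
    have i1 : IsFiniteMeasure (M₁.withDensity (ω N)) := isFiniteMeasure_withDensity hfin
    have i2 : IsFiniteMeasure (M₂.withDensity (ω N)) :=
      isFiniteMeasure_withDensity (heq ▸ hfin)
    refine ext_of_forall_lintegral_eq_of_IsFiniteMeasure fun f => ?_
    have hf : Continuous fun y => (f y : ℝ) := by fun_prop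
    rw [lintegral_withDensity_eq_lintegral_mul _ (hω N) (by fun_prop),
      lintegral_withDensity_eq_lintegral_mul _ (hω N) (by fun_prop)]
    obtain ⟨-, h2⟩ := htest (fun y => cut N y * f y) ((hcut N).mul hf) ((hcutc N).mul_right)
      fun y => mul_nonneg (hcut0 N y) (f y).2
    convert h2 using 2 with y y <;> ext y <;>
    · rw [Pi.mul_apply, mul_right_comm, ENNReal.ofReal_mul' (f y).coe_nonneg,
        ENNReal.ofReal_coe_nnreal]
  have hU := (Measure.restrict_iUnion_congr (s := fun N => {y | ω N y ≠ 0})).2 fun N =>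
    restrict_eq_of_withDensity_eq (hω N) (fun _ => ENNReal.ofReal_ne_top) (hdens N)
  have hUm : MeasurableSet (⋃ N, {y | ω N y ≠ 0}) :=
    MeasurableSet.iUnion fun N => hω N (measurableSet_singleton 0).compl
  have hmem : ∀ y : Fin (k + 1) → Rn k, (∀ i : Fin k, y i.succ ≠ 0) →
      y ∈ ⋃ N, {y | ω N y ≠ 0} := by
    intro y hy
    obtain ⟨N, hN⟩ := exists_nat_gt ‖y‖
    refine mem_iUnion.2 ⟨N, (ENNReal.ofReal_pos.2 (mul_pos ?_ ?_)).ne'⟩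
    · exact lt_max_of_lt_right (by linarith)
    · exact Finset.prod_pos fun i _ => norm_pos_iff.2 (hy i)
  rw [Measure.restrict_eq_self_of_ae_mem, Measure.restrict_eq_self_of_ae_mem] at hU
  · exact hU
  · refine (ae_map_iff (by fun_prop) hUm).2 ((withDensity_absolutelyContinuous _ _).ae_le ?_)
    filter_upwards [hr] with p hp
    refine hmem _ fun i => ?_
    rw [← norm_ne_zero_iff, norm_placed_succ, Pi.zero_apply, add_zero, Real.sqrt_sq hp.le]
    exact hp.ne'
  · refine (ae_map_iff (by fun_prop) hUm).2 ?_
    filter_upwards [ae_rowDet_ne_zero k] with Y hY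
    refine hmem _ fun i hi => hY ?_
    -- a vertex at the circumcentre forces all vertices of the edge to coincide
    have h1 := congrFun (sqExcess_centred hY 0) i
    rw [sqExcess, hi, norm_zero, Pi.zero_apply] at h1
    have h2 : centred Y 0 0 = 0 := by
      rw [← norm_eq_zero, ← sq_eq_zero_iff]
      linarith
    have h3 : Y i = 0 := by
      have : Y i = centred Y 0 i.succ - centred Y 0 0 := by simp [centred]
      rw [this, hi, h2, sub_zero]
    exact Matrix.det_eq_zero_of_row_eq_zero i fun l => by simp [h3]

/-- The **spherical Blaschke–Petkantschin formula** modulo translations: the edges of a random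
simplex in `ℝᵏ` are produced by choosing a simplex inscribed in a sphere of radius `r`. -/
theorem lintegral_eq_lintegral_spherical (hk : 0 < k) {Q : (Fin k → Rn k) → ℝ≥0∞}
    (hQ : Measurable Q) :
    ∫⁻ Y, Q Y = ∫⁻ p, sphericalJacobian p *
      Q (fun i => p.2.1 • ((p.2.2 i : Rn k) - (p.1 : Rn k))) ∂(inscribedMeasure k) := by
  have h1 : ∀ Y : Fin k → Rn k, Q Y = Q (edges (centred Y 0)) := fun Y => by
    rw [centred, edges_cons]
  have hQe : Measurable fun y : Fin (k + 1) → Rn k => Q (edges y) := by fun_prop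
  have h2 := lintegral_map (μ := (volume : Measure (Fin k → Rn k))) hQe
    (g := fun Y => centred Y 0) (by fun_prop)
  rw [lintegral_congr h1]
  rw [map_centred_eq_map_placed hk, lintegral_map hQe (by fun_prop),
    lintegral_withDensity_eq_lintegral_mul _ (by fun_prop) (by fun_prop)] at h2
  refine h2.symm.trans (lintegral_congr_ae ?_)
  have h3 : ∀ᵐ r ∂((volume : Measure ℝ).restrict (Ioi 0)), 0 < r :=
    ae_restrict_mem measurableSet_Ioi
  have h4 := (Measure.quasiMeasurePreserving_fst (μ := (volume : Measure ℝ).restrict (Ioi 0))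
    (ν := Measure.pi fun _ : Fin k => sphereVol k)).ae h3
  have h5 := (Measure.quasiMeasurePreserving_snd (μ := sphereVol k)
    (ν := ((volume : Measure ℝ).restrict (Ioi 0)).prod
      (Measure.pi fun _ : Fin k => sphereVol k))).ae h4
  filter_upwards [h5] with p hp
  have hs : √(p.2.1 ^ 2) = p.2.1 := Real.sqrt_sq (le_of_lt hp)
  have hedges : edges (placed p 0) = fun i => p.2.1 • ((p.2.2 i : Rn k) - (p.1 : Rn k)) := by
    ext1 i
    simp [edges, placed, smul_sub, hs]
  simp only [Pi.mul_apply, hedges]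

end Spherical

/-! ### The volume of a simplex -/

/-- The corner simplex `{t | 0 ≤ tᵢ, ∑ tᵢ ≤ s}` of `ℝᵏ`. -/
def cornerSimplex (k : ℕ) (s : ℝ) : Set (Fin k → ℝ) :=
  {t | (∀ i, 0 ≤ t i) ∧ ∑ i, t i ≤ s}

theorem measurableSet_cornerSimplex (k : ℕ) (s : ℝ) : MeasurableSet (cornerSimplex k s) := by
  have h1 : IsClosed {t : Fin k → ℝ | ∀ i, 0 ≤ t i} := by
    have h : {t : Fin k → ℝ | ∀ i, 0 ≤ t i} = ⋂ i, {t | 0 ≤ t i} := by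
      ext t
      simp
    rw [h]
    exact isClosed_iInter fun i => isClosed_le continuous_const (continuous_apply i)
  have h2 : IsClosed {t : Fin k → ℝ | ∑ i, t i ≤ s} :=
    isClosed_le (continuous_finsetSum _ fun i _ => continuous_apply i) continuous_const
  exact (h1.inter h2).measurableSet

theorem finCons_mem_cornerSimplex {k : ℕ} {s a : ℝ} {y : Fin k → ℝ} :
    (Fin.cons a y : Fin (k + 1) → ℝ) ∈ cornerSimplex (k + 1) s ↔
      0 ≤ a ∧ y ∈ cornerSimplex k (s - a) := by
  simp only [cornerSimplex, mem_ofPred_eq, Fin.forall_fin_succ, Fin.cons_zero, Fin.cons_succ,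
    Fin.sum_univ_succ, le_sub_iff_add_le', and_assoc]

theorem cornerSimplex_eq_empty {k : ℕ} {s : ℝ} (hs : s < 0) : cornerSimplex k s = ∅ := by
  refine eq_empty_of_forall_notMem fun t ht => ?_
  exact (hs.trans_le (Finset.sum_nonneg fun i _ => ht.1 i)).not_ge ht.2

theorem integral_sub_pow_div_factorial (k : ℕ) (s : ℝ) :
    ∫ a in (0 : ℝ)..s, (s - a) ^ k / k ! = s ^ (k + 1) / (k + 1)! := by
  rw [intervalIntegral.integral_comp_sub_left (fun x => x ^ k / (k ! : ℝ)) s, sub_self, sub_zero,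
    intervalIntegral.integral_div, integral_pow, zero_pow (Nat.succ_ne_zero k), sub_zero,
    Nat.factorial_succ, Nat.cast_mul, div_div]
  push_cast
  rfl

theorem volume_cornerSimplex (k : ℕ) {s : ℝ} (hs : 0 ≤ s) :
    volume (cornerSimplex k s) = ENNReal.ofReal (s ^ k / k !) := by
  induction k generalizing s with
  | zero =>
    have h : cornerSimplex 0 s = univ := eq_univ_of_forall fun t => by simpa [cornerSimplex] using hs
    simp [h, volume_pi]
  | succ k ih =>
    have hslice (a : ℝ) : ∫⁻ y, (cornerSimplex (k + 1) s).indicator 1 (Fin.cons a y)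
        ∂(Measure.pi fun _ : Fin k => (volume : Measure ℝ)) =
        (Icc 0 s).indicator (fun a => ENNReal.ofReal ((s - a) ^ k / k !)) a := by
      by_cases ha : a ∈ Icc 0 s
      · rw [indicator_of_mem ha, ← ih (sub_nonneg.mpr ha.2),
          ← lintegral_indicator_one (measurableSet_cornerSimplex k (s - a)), volume_pi]
        refine lintegral_congr fun y => ?_
        by_cases hy : y ∈ cornerSimplex k (s - a)
        · rw [indicator_of_mem hy, indicator_of_mem (finCons_mem_cornerSimplex.mpr ⟨ha.1, hy⟩)]
          rfl
        · rw [indicator_of_notMem hy,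
            indicator_of_notMem fun h => hy (finCons_mem_cornerSimplex.mp h).2]
      · rw [indicator_of_notMem ha, ← lintegral_zero]
        refine lintegral_congr fun y => indicator_of_notMem (fun h => ?_) _
        obtain ⟨h0, hy⟩ := finCons_mem_cornerSimplex.mp h
        refine ha ⟨h0, not_lt.mp fun hlt => ?_⟩
        rw [cornerSimplex_eq_empty (sub_neg.mpr hlt)] at hy
        exact hy
    rw [← lintegral_indicator_one (measurableSet_cornerSimplex (k + 1) s), volume_pi,
      lintegral_pi_finCons volume
        (measurable_one.indicator (measurableSet_cornerSimplex (k + 1) s)),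
      lintegral_congr hslice, lintegral_indicator measurableSet_Icc,
      ← ofReal_integral_eq_lintegral_ofReal, integral_Icc_eq_integral_Ioc,
      ← intervalIntegral.integral_of_le hs, integral_sub_pow_div_factorial]
    · exact (Continuous.integrableOn_Icc (by fun_prop))
    · refine (ae_restrict_iff' measurableSet_Icc).mpr (Filter.Eventually.of_forall fun a ha => ?_)
      exact div_nonneg (pow_nonneg (sub_nonneg.mpr ha.2) k) (Nat.cast_nonneg _)

/-- A simplex is the translate of the image of the corner simplex under the linear map that sends
the standard basis to its edges at the vertex `v 0`. -/
theorem convexHull_range_eq_image_cornerSimplex {V : Type*} [AddCommGroup V] [Module ℝ V] {k : ℕ}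
    (v : Fin (k + 1) → V) :
    convexHull ℝ (range v) = (fun t => v 0 + ∑ i, t i • edges v i) '' cornerSimplex k 1 := by
  have hstd : convexHull ℝ (range v) =
      (fun w : Fin (k + 1) → ℝ => ∑ i, w i • v i) '' stdSimplex ℝ (Fin (k + 1)) := by
    have h := LinearMap.image_convexHull (Fintype.linearCombination ℝ v)
      (range fun i : Fin (k + 1) => Pi.single i (1 : ℝ))
    rw [convexHull_rangle_single_eq_stdSimplex, ← range_comp] at h
    have hv : (Fintype.linearCombination ℝ v ∘ fun i : Fin (k + 1) => Pi.single i (1 : ℝ)) = v := by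
      funext i
      simp [Fintype.linearCombination_apply_single]
    rw [hv] at h
    exact h.symm
  have hsum (a : ℝ) (t : Fin k → ℝ) (h : a + ∑ i, t i = 1) :
      a • v 0 + ∑ i, t i • v i.succ = v 0 + ∑ i, t i • edges v i := by
    simp only [edges, smul_sub, Finset.sum_sub_distrib, ← Finset.sum_smul]
    rw [eq_sub_of_add_eq h, sub_smul, one_smul]
    abel
  rw [hstd]
  ext x
  constructor
  · rintro ⟨w, hw, rfl⟩
    have hw1 := hw.2
    rw [Fin.sum_univ_succ] at hw1
    refine ⟨fun i => w i.succ, ⟨fun i => hw.1 _, ?_⟩, ?_⟩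
    · linarith [hw.1 0]
    · simp only [Fin.sum_univ_succ]
      exact (hsum _ _ hw1).symm
  · rintro ⟨t, ht, rfl⟩
    refine ⟨Fin.cons (1 - ∑ i, t i) t, ⟨fun i => ?_, ?_⟩, ?_⟩
    · refine Fin.cases ?_ (fun j => ?_) i
      · simpa using ht.2
      · simpa using ht.1 j
    · simp [Fin.sum_univ_succ]
    · simp only [Fin.sum_univ_succ, Fin.cons_zero, Fin.cons_succ]
      exact hsum _ _ (by ring)

/-- The volume of a simplex is the absolute determinant of its edge vectors divided by `k!`. The
formula includes degenerate simplices, for which both sides vanish. -/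
theorem factorial_mul_volume_convexHull {k : ℕ} (v : Fin (k + 1) → Rn k) :
    (k ! : ℝ≥0∞) * volume (convexHull ℝ (range v)) = ENNReal.ofReal |rowDet (edges v)| := by
  set b := EuclideanSpace.basisFun (Fin k) ℝ with hb
  set f : Rn k →ₗ[ℝ] Rn k := b.toBasis.constr ℝ (edges v) with hf
  have hdet : LinearMap.det f = rowDet (edges v) := by
    have h := rowDet_comp f b
    have h1 : (fun i => f (b i)) = edges v := by
      funext i
      have := b.toBasis.constr_basis ℝ (edges v) i
      rwa [OrthonormalBasis.coe_toBasis] at this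
    have h2 : rowDet b = 1 := by
      rw [rowDet_eq_basis_det]
      simpa using b.toBasis.det_self
    rw [h1, h2, mul_one] at h
    exact h.symm
  have himage : convexHull ℝ (range v) =
      (fun x => v 0 + x) '' (f '' (WithLp.ofLp ⁻¹' cornerSimplex k 1)) := by
    rw [convexHull_range_eq_image_cornerSimplex, image_image]
    have hfapp (t : Rn k) : f t = ∑ i, t i • edges v i := by
      rw [hf, Module.Basis.constr_apply_fintype]
      rfl
    ext x
    constructor
    · rintro ⟨t, ht, rfl⟩
      exact ⟨WithLp.toLp 2 t, ht, by simp only [hfapp]⟩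
    · rintro ⟨t, ht, rfl⟩
      exact ⟨t.ofLp, ht, by simp only [hfapp]⟩
  have hvol : volume (WithLp.ofLp ⁻¹' cornerSimplex k 1 : Set (Rn k)) =
      ENNReal.ofReal (1 / k !) := by
    rw [(PiLp.volume_preserving_ofLp (Fin k)).measure_preimage
      (measurableSet_cornerSimplex k 1).nullMeasurableSet, volume_cornerSimplex k zero_le_one,
      one_pow]
  have hfact : (0 : ℝ) < k ! := Nat.cast_pos.mpr (Nat.factorial_pos k)
  rw [himage, image_add_left, measure_preimage_add, Measure.addHaar_image_linearMap, hvol, hdet,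
    mul_left_comm, ← ENNReal.ofReal_natCast, ← ENNReal.ofReal_mul hfact.le,
    mul_one_div_cancel hfact.ne', ENNReal.ofReal_one, mul_one]

/-! ### Integration over the spheres inscribed in a fixed direction -/

section Flat

variable {k n : ℕ}

/-- The contribution of the plane `T(ℝᵏ)` to the affine formula, where `T` is meant to be an
isometry of `ℝᵏ` into `ℝⁿ`: the integral of `f` over the simplices inscribed in the spheres with
arbitrary centre `z` and radius `r` that are parallel to that plane. -/
noncomputable def flatIntegral (f : (Fin (k + 1) → Rn n) → ℝ≥0∞) (T : Rn k → Rn n) : ℝ≥0∞ :=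
  ∫⁻ z : Rn n, ∫⁻ r in Ici (0 : ℝ), (∫⁻ u : Fin (k + 1) → Metric.sphere (0 : Rn k) 1,
    f (fun i => z + r • T (u i)) * ENNReal.ofReal r ^ (n * k - 1) *
      ENNReal.ofReal |rowDet (edges fun i => (u i : Rn k))| ^ (n - k + 1)
    ∂(Measure.pi fun _ => sphereVol k))

/-- The integrand of `flatIntegral` is jointly measurable, also in a parameter of the plane. -/
theorem measurable_flatIntegrand {α : Type*} [MeasurableSpace α]
    {f : (Fin (k + 1) → Rn n) → ℝ≥0∞} (hf : Measurable f) {T : α → Rn k → Rn n}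
    (hT : Measurable (Function.uncurry T)) :
    Measurable fun p : ((α × Rn n) × ℝ) × (Fin (k + 1) → Metric.sphere (0 : Rn k) 1) =>
      f (fun i => p.1.1.2 + p.1.2 • T p.1.1.1 (p.2 i)) * ENNReal.ofReal p.1.2 ^ (n * k - 1) *
        ENNReal.ofReal |rowDet (edges fun i => (p.2 i : Rn k))| ^ (n - k + 1) := by
  have h1 : Measurable fun p : ((α × Rn n) × ℝ) × (Fin (k + 1) → Metric.sphere (0 : Rn k) 1) =>
      f (fun i => p.1.1.2 + p.1.2 • T p.1.1.1 (p.2 i)) := by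
    refine hf.comp (measurable_pi_lambda _ fun i => ?_)
    have h2 : Measurable
        fun p : ((α × Rn n) × ℝ) × (Fin (k + 1) → Metric.sphere (0 : Rn k) 1) =>
        (p.1.1.1, (p.2 i : Rn k)) := by fun_prop
    have h3 := hT.comp h2
    simp only [Function.comp_def, Function.uncurry] at h3
    fun_prop
  fun_prop

theorem measurable_flatIntegral {α : Type*} [MeasurableSpace α]
    {f : (Fin (k + 1) → Rn n) → ℝ≥0∞} (hf : Measurable f) {T : α → Rn k → Rn n}
    (hT : Measurable (Function.uncurry T)) : Measurable fun a => flatIntegral f (T a) :=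
  (measurable_flatIntegrand hf hT).lintegral_prod_right'.lintegral_prod_right'.lintegral_prod_right'

/-- If the plane `T(ℝᵏ)` contributes nothing to the integral of the indicator function of `N`, then
its contribution to the integral of `f` depends only on the values of `f` outside `N`. -/
theorem flatIntegral_congr {N : Set (Fin (k + 1) → Rn n)} (hN : MeasurableSet N)
    {f f' : (Fin (k + 1) → Rn n) → ℝ≥0∞} (hff' : ∀ x ∉ N, f x = f' x) {T : Rn k → Rn n}
    (hT : Measurable T) (h : flatIntegral (N.indicator 1) T = 0) :
    flatIntegral f T = flatIntegral f' T := by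
  have hm := measurable_flatIntegrand (α := Unit) (measurable_one.indicator hN) (T := fun _ => T)
    (hT.comp measurable_snd)
  have hz := (lintegral_eq_zero_iff (hm.lintegral_prod_right'.lintegral_prod_right'.comp
    (measurable_const.prodMk measurable_id : Measurable fun z : Rn n => ((), z)))).1 h
  refine lintegral_congr_ae ?_
  filter_upwards [hz] with z hz
  have hr := (lintegral_eq_zero_iff (hm.lintegral_prod_right'.comp
    (measurable_const.prodMk measurable_id : Measurable fun r : ℝ => (((), z), r)))).1 hz
  refine lintegral_congr_ae ?_
  filter_upwards [hr] with r hr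
  have hu := (lintegral_eq_zero_iff (hm.comp (measurable_const.prodMk measurable_id :
    Measurable fun u : Fin (k + 1) → Metric.sphere (0 : Rn k) 1 => ((((), z), r), u)))).1 hr
  refine lintegral_congr_ae ?_
  filter_upwards [hu] with u hu
  by_cases hx : (fun i => z + r • T (u i)) ∈ N
  · simp only [Function.comp_apply, indicator_of_mem hx, Pi.one_apply, one_mul,
      Pi.zero_apply] at hu
    rw [mul_assoc, mul_assoc, hu, mul_zero, mul_zero]
  · rw [hff' _ hx]

theorem lintegral_eq_lintegral_base_edges {f : (Fin (k + 1) → Rn n) → ℝ≥0∞} (hf : Measurable f) :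
    ∫⁻ x, f x =
      ∫⁻ y : Fin k → Rn n, ∫⁻ z : Rn n, f (Fin.cons z fun i => z + y i) := by
  have hm : Measurable fun p : Rn n × (Fin k → Rn n) =>
      f (Fin.cons p.1 fun i => p.1 + p.2 i) := by
    fun_prop
  rw [volume_pi, lintegral_pi_finCons volume hf, ← volume_pi]
  refine (lintegral_congr fun z => ?_).trans (lintegral_lintegral_swap hm.aemeasurable)
  exact (lintegral_add_left_eq_self (fun y : Fin k → Rn n => f (Fin.cons z y)) fun _ => z).symm

/-- The spherical formula in the plane `T(ℝᵏ)`, combined with the translation that moves the base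
point of the simplex to the centre of its circumscribed sphere. -/
theorem lintegral_edges_eq_flatIntegral (hk : 0 < k) (hkn : k ≤ n)
    {f : (Fin (k + 1) → Rn n) → ℝ≥0∞} (hf : Measurable f) (T : Rn k →ₗᵢ[ℝ] Rn n) :
    ∫⁻ Y : Fin k → Rn k, (∫⁻ z : Rn n, f (Fin.cons z fun i => z + T (Y i))) *
      ENNReal.ofReal |rowDet Y| ^ (n - k) = flatIntegral f T := by
  have hT := T.continuous.measurable
  have hm := measurable_flatIntegrand (α := Unit) hf (T := fun _ => T) (hT.comp measurable_snd)
  set G : Rn n → ℝ → (Fin (k + 1) → Metric.sphere (0 : Rn k) 1) → ℝ≥0∞ := fun z r u =>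
    f (fun i => z + r • T (u i)) * ENNReal.ofReal r ^ (n * k - 1) *
      ENNReal.ofReal |rowDet (edges fun i => (u i : Rn k))| ^ (n - k + 1) with hG
  have hGm {α : Type} [MeasurableSpace α] {a : α → Rn n} {b : α → ℝ}
      {c : α → Fin (k + 1) → Metric.sphere (0 : Rn k) 1} (ha : Measurable a) (hb : Measurable b)
      (hc : Measurable c) : Measurable fun p => G (a p) (b p) (c p) :=
    hm.comp (((measurable_const.prodMk ha : Measurable fun p => ((), a p)).prodMk hb).prodMk hc)
  have hexp : k * k - 1 + k * (n - k) = n * k - 1 := by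
    have h1 : 1 ≤ k * k := Nat.mul_pos hk hk
    have h2 : k * k + k * (n - k) = n * k := by
      rw [← mul_add, Nat.add_sub_cancel' hkn, mul_comm]
    omega
  -- the base vertex `z` is replaced by the centre `z - r T u₀` of the sphere
  have hpoint (u₀ : Metric.sphere (0 : Rn k) 1) (u : Fin k → Metric.sphere (0 : Rn k) 1) {r : ℝ}
      (hr : 0 < r) : sphericalJacobian (u₀, r, u) *
        ((∫⁻ z : Rn n, f (Fin.cons z fun i => z + T (r • ((u i : Rn k) - (u₀ : Rn k))))) *
          ENNReal.ofReal |rowDet fun i => r • ((u i : Rn k) - (u₀ : Rn k))| ^ (n - k)) =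
      ∫⁻ z, G z r (Fin.cons u₀ u) := by
    have h1 : (edges fun i => ((Fin.cons u₀ u : Fin (k + 1) → Metric.sphere (0 : Rn k) 1) i :
        Rn k)) = fun i => (u i : Rn k) - (u₀ : Rn k) := by
      funext i
      simp [edges]
    have h2 : ∫⁻ z : Rn n, f (Fin.cons z fun i => z + T (r • ((u i : Rn k) - (u₀ : Rn k)))) =
        ∫⁻ z : Rn n, f (fun i => z + r • T ((Fin.cons u₀ u :
          Fin (k + 1) → Metric.sphere (0 : Rn k) 1) i)) := by
      rw [← lintegral_add_right_eq_self _ (r • T u₀)]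
      refine lintegral_congr fun z => congrArg f (funext fun i => ?_)
      refine Fin.cases ?_ (fun i => ?_) i
      · simp
      · simp only [Fin.cons_succ, map_smul, map_sub, smul_sub]
        abel
    simp only [hG, h1, mul_assoc]
    rw [lintegral_mul_const _ (by fun_prop), h2, mul_left_comm]
    congr 1
    rw [rowDet_smul, abs_mul, abs_of_pos (pow_pos hr k), ENNReal.ofReal_mul (pow_nonneg hr.le k),
      ENNReal.ofReal_pow hr.le, mul_pow, ← pow_mul, ← hexp, pow_add, pow_succ, sphericalJacobian]
    ring
  have hH : Measurable fun Y : Fin k → Rn k =>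
      ∫⁻ z : Rn n, f (Fin.cons z fun i => z + T (Y i)) := by
    have : Measurable fun p : (Fin k → Rn k) × Rn n =>
        f (Fin.cons p.2 fun i => p.2 + T (p.1 i)) := by fun_prop
    exact this.lintegral_prod_right'
  rw [lintegral_eq_lintegral_spherical hk (by fun_prop), lintegral_inscribedMeasure]
  · calc _ = ∫⁻ u₀, (∫⁻ r in Ioi (0 : ℝ), (∫⁻ u, (∫⁻ z, G z r (Fin.cons u₀ u))
          ∂(Measure.pi fun _ => sphereVol k))) ∂(sphereVol k) := by
          refine lintegral_congr fun u₀ => setLIntegral_congr_fun measurableSet_Ioi fun r hr => ?_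
          exact lintegral_congr fun u => hpoint u₀ u hr
      _ = ∫⁻ r in Ioi (0 : ℝ), (∫⁻ u₀, (∫⁻ u, (∫⁻ z, G z r (Fin.cons u₀ u))
          ∂(Measure.pi fun _ => sphereVol k)) ∂(sphereVol k)) := by
          refine lintegral_lintegral_swap ?_
          have h : Measurable fun p : ((Metric.sphere (0 : Rn k) 1 × ℝ) ×
              (Fin k → Metric.sphere (0 : Rn k) 1)) × Rn n =>
              G p.2 p.1.1.2 (Fin.cons p.1.1.1 p.1.2) :=
            hGm (by fun_prop) (by fun_prop) (by fun_prop)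
          exact h.lintegral_prod_right'.lintegral_prod_right'.aemeasurable
      _ = ∫⁻ r in Ioi (0 : ℝ), (∫⁻ u, (∫⁻ z, G z r u) ∂(Measure.pi fun _ => sphereVol k)) := by
          refine lintegral_congr fun r => (lintegral_pi_finCons (sphereVol k)
            (F := fun u => ∫⁻ z, G z r u) ?_).symm
          have h : Measurable fun p : (Fin (k + 1) → Metric.sphere (0 : Rn k) 1) × Rn n =>
              G p.2 r p.1 := hGm (by fun_prop) (by fun_prop) (by fun_prop)
          exact h.lintegral_prod_right'
      _ = ∫⁻ r in Ioi (0 : ℝ), ∫⁻ z, (∫⁻ u, G z r u ∂(Measure.pi fun _ => sphereVol k)) := by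
          refine lintegral_congr fun r => lintegral_lintegral_swap ?_
          exact (hGm (by fun_prop) (by fun_prop) (by fun_prop)).aemeasurable
      _ = ∫⁻ z, ∫⁻ r in Ioi (0 : ℝ), (∫⁻ u, G z r u ∂(Measure.pi fun _ => sphereVol k)) := by
          refine lintegral_lintegral_swap ?_
          have h : Measurable fun p : (ℝ × Rn n) × (Fin (k + 1) → Metric.sphere (0 : Rn k) 1) =>
              G p.1.2 p.1.1 p.2 := hGm (by fun_prop) (by fun_prop) (by fun_prop)
          exact h.lintegral_prod_right'.aemeasurable
      _ = flatIntegral f T := by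
          simp only [restrict_Ioi_eq_restrict_Ici]
          rfl
  · have h1 : Measurable fun p : Metric.sphere (0 : Rn k) 1 ×
        (ℝ × (Fin k → Metric.sphere (0 : Rn k) 1)) => fun i =>
        p.2.1 • ((p.2.2 i : Rn k) - (p.1 : Rn k)) := by fun_prop
    have h2 := hH.comp h1
    simp only [Function.comp_def] at h2
    fun_prop

/-- The affine formula as an average over rotations of a fixed plane. -/
theorem lintegral_eq_lintegral_flatIntegral (hk : 0 < k) (hkn : k ≤ n)
    {f : (Fin (k + 1) → Rn n) → ℝ≥0∞} (hf : Measurable f) :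
    ∫⁻ x, f x = ENNReal.ofReal (LGrass.mass k n) * ∫⁻ g, flatIntegral f
      (fun v => (g : Rn n →L[ℝ] Rn n) (coordIncl hkn v)) ∂(OrthGroup.haarProb (Rn n)) := by
  have hH : Measurable fun y : Fin k → Rn n =>
      ∫⁻ z : Rn n, f (Fin.cons z fun i => z + y i) := by
    have : Measurable fun p : (Fin k → Rn n) × Rn n =>
        f (Fin.cons p.2 fun i => p.2 + p.1 i) := by fun_prop
    exact this.lintegral_prod_right'
  rw [lintegral_eq_lintegral_base_edges hf, lintegral_eq_lintegral_rotate hkn hH]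
  congr 1
  exact lintegral_congr fun g => lintegral_edges_eq_flatIntegral hk hkn hf
    ((Unitary.linearIsometryEquiv g).toLinearIsometry.comp (coordIncl hkn))

end Flat

/-! ### From isometries to the Grassmannian -/

section SphereMap

variable {E F : Type*} [NormedAddCommGroup E] [InnerProductSpace ℝ E] [NormedAddCommGroup F]
  [InnerProductSpace ℝ F]

/-- The homeomorphism of unit spheres induced by an isometry. -/
def sphereHomeomorph (e : E ≃ₗᵢ[ℝ] F) :
    Metric.sphere (0 : E) 1 ≃ₜ Metric.sphere (0 : F) 1 :=
  e.toHomeomorph.subtype fun x => by simp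

theorem coe_sphereHomeomorph (e : E ≃ₗᵢ[ℝ] F) (u : Metric.sphere (0 : E) 1) :
    (sphereHomeomorph e u : F) = e u :=
  rfl

theorem measurePreserving_sphereHomeomorph [MeasurableSpace E] [BorelSpace E] [MeasurableSpace F]
    [BorelSpace F] {μ : Measure E} {ν : Measure F} (e : E ≃ₗᵢ[ℝ] F)
    (h : MeasurePreserving e μ ν) :
    MeasurePreserving (sphereHomeomorph e) μ.toSphere ν.toSphere := by
  have hm := (sphereHomeomorph e).continuous.measurable
  refine ⟨hm, Measure.ext fun s hs => ?_⟩
  rw [Measure.map_apply hm hs, Measure.toSphere_apply' _ (hm hs), Measure.toSphere_apply' _ hs,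
    e.toLinearEquiv.finrank_eq,
    ← h.measure_preimage_emb e.toHomeomorph.measurableEmbedding]
  congr 2
  ext x
  simp only [mem_preimage, mem_smul, mem_image]
  constructor
  · rintro ⟨t, ht, _, ⟨u, hu, rfl⟩, rfl⟩
    exact ⟨t, ht, _, ⟨sphereHomeomorph e u, hu, rfl⟩, by rw [coe_sphereHomeomorph, map_smul]⟩
  · rintro ⟨t, ht, _, ⟨u, hu, rfl⟩, hx⟩
    refine ⟨t, ht, _, ⟨(sphereHomeomorph e).symm u, ?_, rfl⟩, e.injective ?_⟩
    · rwa [Homeomorph.apply_symm_apply]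
    · rw [map_smul, ← coe_sphereHomeomorph, Homeomorph.apply_symm_apply, hx]

end SphereMap

namespace LGrass

variable {k n : ℕ}

/-- The contribution of the subspace `L` to the affine formula: the integral of `f` over the simplices
which are parallel to `L` and inscribed in spheres with arbitrary centre `z` and radius `r`. -/
noncomputable def sphereIntegral (f : (Fin (k + 1) → Rn n) → ℝ≥0∞) (L : LGrass (Rn n) k) : ℝ≥0∞ :=
  ∫⁻ z : Rn n, ∫⁻ r : ℝ in Ici 0, ∫⁻ u : Fin (k + 1) → L.unitSphere,
    f (fun i => z + r • ((u i : L.1) : Rn n)) * ENNReal.ofReal r ^ (n * k - 1) *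
      ((k ! : ℝ≥0∞) * L.simplexVolume u) ^ (n - k + 1)
    ∂(Measure.pi fun _ => L.sphereMeasure) ∂volume ∂volume

theorem measurePreserving_lebesgue (L : LGrass (Rn n) k) (e : Rn k ≃ₗᵢ[ℝ] L.1) :
    MeasurePreserving e volume L.lebesgue :=
  e.measurePreserving

theorem factorial_mul_simplexVolume (L : LGrass (Rn n) k) (e : Rn k ≃ₗᵢ[ℝ] L.1)
    (u : Fin (k + 1) → Metric.sphere (0 : Rn k) 1) :
    (k ! : ℝ≥0∞) * L.simplexVolume (fun i => sphereHomeomorph e (u i)) =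
      ENNReal.ofReal |rowDet (edges fun i => (u i : Rn k))| := by
  rw [← factorial_mul_volume_convexHull, simplexVolume,
    ← (L.measurePreserving_lebesgue e).measure_preimage_emb
      e.toHomeomorph.measurableEmbedding]
  congr 2
  have h := LinearMap.image_convexHull e.toLinearEquiv.toLinearMap (range fun i => (u i : Rn k))
  rw [← range_comp] at h
  change _ = convexHull ℝ (range fun i => e (u i)) at h
  simp only [coe_sphereHomeomorph]
  rw [← h]
  exact preimage_image_eq _ e.injective

/-- The contribution of the subspace `L` can be computed in the coordinates of any isometry of `ℝᵏ`
onto `L`. No measurability of `f` is needed since the isometry is a homeomorphism onto `L`. -/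
theorem sphereIntegral_eq_flatIntegral (f : (Fin (k + 1) → Rn n) → ℝ≥0∞) (L : LGrass (Rn n) k)
    (T : Rn k →ₗᵢ[ℝ] Rn n) (hT : LinearMap.range T.toLinearMap = L.1) :
    sphereIntegral f L = flatIntegral f T := by
  obtain ⟨V, hV⟩ := L
  obtain rfl : LinearMap.range T.toLinearMap = V := hT
  set L : LGrass (Rn n) k := ⟨LinearMap.range T.toLinearMap, hV⟩ with hL
  let e : Rn k ≃ₗᵢ[ℝ] L.1 := T.equivRange
  have hs : MeasurePreserving (sphereHomeomorph e) (sphereVol k) L.sphereMeasure :=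
    measurePreserving_sphereHomeomorph e (L.measurePreserving_lebesgue e)
  have hσ : IsFiniteMeasure L.sphereMeasure := by
    refine ⟨?_⟩
    rw [← hs.measure_preimage MeasurableSet.univ.nullMeasurableSet]
    exact measure_lt_top _ _
  have hp : MeasurePreserving
      (MeasurableEquiv.piCongrRight fun _ : Fin (k + 1) =>
        (sphereHomeomorph e).toMeasurableEquiv)
      (Measure.pi fun _ => sphereVol k) (Measure.pi fun _ => L.sphereMeasure) :=
    measurePreserving_pi _ _ fun _ => hs
  refine lintegral_congr fun z => lintegral_congr fun r => ?_
  rw [← hp.lintegral_comp_emb (MeasurableEquiv.measurableEmbedding _)]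
  refine lintegral_congr fun u => ?_
  have h := L.factorial_mul_simplexVolume e u
  rw [← h]
  rfl

theorem range_coordIncl (hkn : k ≤ n) :
    LinearMap.range (coordIncl hkn).toLinearMap = (coordPlane hkn).1 :=
  Module.Basis.constr_range ..

theorem range_comp_coordIncl (hkn : k ≤ n) (g : OrthGroup (Rn n)) :
    LinearMap.range ((Unitary.linearIsometryEquiv g).toLinearIsometry.comp
      (coordIncl hkn)).toLinearMap = (rotate g (coordPlane hkn)).1 := by
  change _ = (coordPlane hkn).1.map _
  rw [← range_coordIncl, ← LinearMap.range_comp]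
  rfl

theorem surjective_rotate_coordPlane (hkn : k ≤ n) :
    Function.Surjective fun g : OrthGroup (Rn n) => rotate g (coordPlane hkn) := by
  intro L
  let e : Rn k ≃ₗᵢ[ℝ] L.1 :=
    ((stdOrthonormalBasis ℝ L.1).reindex (finCongr L.2)).repr.symm
  obtain ⟨a, ha⟩ := exists_isometry_extending hkn (L.1.subtypeₗᵢ.comp e.toLinearIsometry)
  refine ⟨Unitary.linearIsometryEquiv.symm a, LGrass.ext ?_⟩
  dsimp only
  rw [← range_comp_coordIncl]
  ext x
  constructor
  · rintro ⟨v, rfl⟩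
    have h : a (coordIncl hkn v) ∈ L.1 := by
      rw [ha]
      exact (e v).2
    exact h
  · intro hx
    refine ⟨e.symm ⟨x, hx⟩, ?_⟩
    have h : a (coordIncl hkn (e.symm ⟨x, hx⟩)) = (e (e.symm ⟨x, hx⟩) : Rn n) := ha _
    rw [e.apply_symm_apply] at h
    exact h

theorem injective_starProjection :
    Function.Injective fun L : LGrass (Rn n) k => L.1.starProjection :=
  fun _ _ h => LGrass.ext (Submodule.starProjection_inj.1 h)

-- The two topological properties below make the Borel structure of the Grassmannian countably
-- separated.
instance instT0Space : T0Space (LGrass (Rn n) k) :=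
  (Topology.IsEmbedding.mk ⟨rfl⟩ injective_starProjection).t0Space

instance instSecondCountableTopology : SecondCountableTopology (LGrass (Rn n) k) :=
  (Topology.IsEmbedding.mk ⟨rfl⟩ injective_starProjection).secondCountableTopology

theorem sphereIntegral_rotate (hkn : k ≤ n) (f : (Fin (k + 1) → Rn n) → ℝ≥0∞)
    (g : OrthGroup (Rn n)) : sphereIntegral f (rotate g (coordPlane hkn)) =
      flatIntegral f (fun v => (g : Rn n →L[ℝ] Rn n) (coordIncl hkn v)) :=
  sphereIntegral_eq_flatIntegral f (rotate g (coordPlane hkn))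
    ((Unitary.linearIsometryEquiv g).toLinearIsometry.comp (coordIncl hkn))
    (range_comp_coordIncl hkn g)

/-- A function on the Grassmannian is measurable as soon as its pullback to the orthogonal group
is: the latter is Polish, and the orbit map onto the countably separated Grassmannian is
surjective. -/
theorem measurable_sphereIntegral (hkn : k ≤ n) {f : (Fin (k + 1) → Rn n) → ℝ≥0∞}
    (hf : Measurable f) : Measurable (sphereIntegral f : LGrass (Rn n) k → ℝ≥0∞) := by
  rw [← (continuous_rotate (coordPlane hkn)).measurable.measurable_comp_iff_of_surjective
    (surjective_rotate_coordPlane hkn)]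
  have h : (sphereIntegral f ∘ fun g : OrthGroup (Rn n) => rotate g (coordPlane hkn)) =
      fun g : OrthGroup (Rn n) => flatIntegral f fun v => (g : Rn n →L[ℝ] Rn n) (coordIncl hkn v) :=
    funext (sphereIntegral_rotate hkn f)
  rw [h]
  have hι := (coordIncl hkn).continuous.measurable
  exact measurable_flatIntegral hf (OrthGroup.measurable_apply.comp
    (measurable_fst.prodMk (hι.comp measurable_snd)))

theorem lintegral_eq_lintegral_sphereIntegral (hk : 0 < k) (hkn : k ≤ n)
    {f : (Fin (k + 1) → Rn n) → ℝ≥0∞} (hf : Measurable f) :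
    ∫⁻ x, f x = ∫⁻ L, sphereIntegral f L ∂(LGrass.measure hkn) := by
  rw [lintegral_eq_lintegral_flatIntegral hk hkn hf, LGrass.measure, lintegral_smul_measure,
    lintegral_map (measurable_sphereIntegral hkn hf) (continuous_rotate _).measurable, smul_eq_mul]
  simp only [sphereIntegral_rotate]

end LGrass

theorem mainTheorem3 (k n : ℕ) (hk : 0 < k) (hkn : k ≤ n)
    (f : (Fin (k + 1) → Rn n) → ℝ≥0∞) (hf : AEMeasurable f volume) :
    ∫⁻ x : Fin (k + 1) → Rn n, f x =
      ∫⁻ L : LGrass (Rn n) k, ∫⁻ z : Rn n, ∫⁻ r : ℝ in Ici 0, ∫⁻ u : Fin (k + 1) → L.unitSphere,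
        f (fun i => z + r • ((u i : L.1) : Rn n)) * ENNReal.ofReal r ^ (n * k - 1) *
          ((k ! : ℝ≥0∞) * L.simplexVolume u) ^ (n - k + 1)
        ∂(Measure.pi fun _ => L.sphereMeasure) ∂volume ∂volume ∂(LGrass.measure hkn) := by
  -- `f` agrees with a Borel function outside a Borel null set `N`; the formula for the indicator
  -- function of `N` shows that almost no `L` sees the difference
  set N := toMeasurable volume {x | f x ≠ hf.mk f x} with hNdef
  have hN : MeasurableSet N := measurableSet_toMeasurable _ _
  have hN0 : volume N = 0 := by
    rw [hNdef, measure_toMeasurable]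
    exact hf.ae_eq_mk
  have hff' : ∀ x ∉ N, f x = hf.mk f x := fun x hx => by
    by_contra h
    exact hx (subset_toMeasurable _ _ h)
  have h1 := LGrass.lintegral_eq_lintegral_sphereIntegral hk hkn (measurable_one.indicator hN)
  rw [lintegral_indicator_one hN, hN0] at h1
  have h2 := (lintegral_eq_zero_iff
    (LGrass.measurable_sphereIntegral hkn (measurable_one.indicator hN))).1 h1.symm
  rw [lintegral_congr_ae hf.ae_eq_mk,
    LGrass.lintegral_eq_lintegral_sphereIntegral hk hkn hf.measurable_mk]
  refine lintegral_congr_ae ?_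
  filter_upwards [h2] with L hL
  change _ = LGrass.sphereIntegral f L
  obtain ⟨g, rfl⟩ := LGrass.surjective_rotate_coordPlane hkn L
  simp only [LGrass.sphereIntegral_rotate, Pi.zero_apply] at hL ⊢
  refine (flatIntegral_congr hN hff' ?_ hL).symm
  have hι := (coordIncl hkn).continuous.measurable
  exact (g : Rn n →L[ℝ] Rn n).continuous.measurable.comp hι
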